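/- Let $F=\mathbb{Q}(\alpha)$, and let $\Lambda_F=F[p_1,p_2,\dots]$ be the ring of symmetric functions over $F$ in variables $x_1,x_2,\dots$, where $p_k=\sum_i x_i^k$. Write $m_\lambda$ for the monomial symmetric functions, $\lambda'$ for the conjugate partition, $\le$ for the dominance order, $l(\lambda)$ for the number of parts of $\lambda$, and $z_\lambda=\prod_{i\ge1}i^{m_i}m_i!$, where $m_i$ is the number of parts of $\lambda$ equal to $i$. Let $\langle\cdot,\cdot\rangle$ be the bilinear form on $\Lambda_F$ with $\langle p_\lambda,p_\mu\rangle=\delta_{\lambda\mu}\,\alpha^{l(\lambda)}z_\lambda$. The Jack functions $P_\lambda(\alpha)$ are determined by $P_\lambda(\alpha)\in m_\lambda+\sum_{\mu<\lambda}F\,m_\mu$ and $\langle P_\lambda(\alpha),P_\mu(\alpha)\rangle=0$ for $\lambda\ne\mu$. Put $Q_\lambda(\alpha)=\langle P_\lambda(\alpha),P_\lambda(\alpha)\rangle^{-1}P_\lambda(\alpha)$, and let $J_\lambda(\alpha)$ be the scalar multiple of $P_\lambda(\alpha)$ in which the coefficient of $m_{(1^{|\lambda|})}$ is $|\lambda|!$.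 Let $q_n(\alpha)=\sum_{\lambda\vdash n}\alpha^{-l(\lambda)}z_\lambda^{-1}p_\lambda$ (so $q_0(\alpha)=1$) and $q_\lambda(\alpha)=q_{\lambda_1}(\alpha)q_{\lambda_2}(\alpha)\cdots$. **Proposition 5.8.** Let $r\ge s\ge0$ be integers, $a=r-s$, and $\lambda^i=(r+i,s-i)$ for $0\le i\le s$. Then $$Q_{\lambda^0}(\alpha)=\sum_{i=0}^{s}a_i(\alpha)\,q_{\lambda^i}(\alpha),\qquad J_{(\lambda^0)'}(\alpha)=\sum_{i=0}^{s}b_{s-i}(\alpha)\,m_{(\lambda^i)'},$$ where $a_0(\alpha)=1$, for $i\ge1$ $$a_i(\alpha)=(-1)^i(a+2i)\,\frac{(a+1)\cdots(a+i-1)}{i!}\cdot\frac{(1-\alpha)\cdots(1-(i-1)\alpha)}{(1+(a+1)\alpha)\cdots(1+(a+i)\alpha)},$$ and for $0\le k\le s$ $$b_k(\alpha)=(s+r-2k)!\prod_{1\le j\le k}(s+1-j)(\alpha+r+1-j).$$ -/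

import Mathlib

namespace Jack

/-- The coefficient field `F = ℚ(α)`. -/
abbrev F : Type := RatFunc ℚ

/-- The indeterminate `α` of `F = ℚ(α)`. -/
noncomputable abbrev α : F := RatFunc.X

/-- The ring of symmetric functions over `F`, as the polynomial ring `F[p₁, p₂, p₃, …]` in the power
sums; `MvPolynomial.X k` is `p_k`. Its realization in the variables `x₀, x₁, x₂, …` is `toSeries`,
which is injective (`toSeries_injective`). -/
abbrev SymFun : Type := MvPolynomial ℕ+ F

/-! Partitions are represented by their Young diagrams: the parts of `μ` are
`μ.rowLen 0 ≥ μ.rowLen 1 ≥ …` (followed by zeros), its weight is `μ.card`, `μ.rowLens` is the list of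
its nonzero parts and `μ.transpose` is the conjugate partition. -/

/-- The two-row partition `(r, s)`, where `s ≤ r`. -/
def twoRow (r s : ℕ) (h : s ≤ r) : YoungDiagram :=
  YoungDiagram.ofRowLens [r, s] (by simpa [List.sortedGE_iff_pairwise] using h)

/-- The dominance ordering: `DomLE μ ν` says that `μ` and `ν` have the same weight and
`μ₁ + ⋯ + μ_k ≤ ν₁ + ⋯ + ν_k` for all `k`. -/
def DomLE (μ ν : YoungDiagram) : Prop :=
  μ.card = ν.card ∧ ∀ k, ∑ i ∈ Finset.range k, μ.rowLen i ≤ ∑ i ∈ Finset.range k, ν.rowLen i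

/-- The strict dominance ordering. -/
def DomLT (μ ν : YoungDiagram) : Prop := DomLE μ ν ∧ μ ≠ ν

open Classical in
/-- The power sum `p_k = ∑ᵢ xᵢᵏ` in the variables `x₀, x₁, …`, as a formal power series. -/
noncomputable def powerSumSeries (k : ℕ+) : MvPowerSeries ℕ F :=
  fun d => if ∃ i, d = Finsupp.single i (k : ℕ) then 1 else 0

/-- The expansion of a symmetric function, given as a polynomial in the power sums, in the variables
`x₀, x₁, …`. -/
noncomputable def toSeries : SymFun →ₐ[F] MvPowerSeries ℕ F :=
  MvPolynomial.aeval powerSumSeries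

/-- The monomial symmetric function `m_μ`: the sum of all distinct monomials in `x₀, x₁, …` whose
nonzero exponents are, up to order, the parts of `μ`. -/
noncomputable def m (μ : YoungDiagram) : MvPowerSeries ℕ F :=
  fun d => if d.support.val.map d = (μ.rowLens : Multiset ℕ) then 1 else 0

/-- `α ^ l(κ) * z_κ` for the partition `κ` which has `d k` parts equal to `k`; here
`z_κ = ∏ k, k ^ d k * (d k)!`. -/
noncomputable def weight (d : ℕ+ →₀ ℕ) : F :=
  α ^ d.degree * d.prod fun k n => ((k : ℕ) : F) ^ n * (n.factorial : F)

/-- The Jack scalar product, the bilinear form with `⟨p_κ, p_κ'⟩ = δ_{κ κ'} α ^ l(κ) z_κ`. -/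
noncomputable def scalar (f g : SymFun) : F :=
  ∑ d ∈ f.support, f.coeff d * g.coeff d * weight d

/-- The defining property of the Jack functions `P_μ`:
`P_μ = m_μ + ∑_{ν < μ} c_{μ ν} m_ν` with `c_{μ ν} ∈ F`, and `⟨P_μ, P_ν⟩ = 0` for `μ ≠ ν`. -/
def IsJackFamily (P : YoungDiagram → SymFun) : Prop :=
  (∀ μ, toSeries (P μ) - m μ ∈ Submodule.span F (m '' {ν | DomLT ν μ})) ∧
    ∀ μ ν, μ ≠ ν → scalar (P μ) (P ν) = 0

/-- The same property for a single partition `μ`: by triangularity, orthogonality of `P_μ` to all other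
Jack functions `P_ν` says that `P_μ` is orthogonal to all `m_ν` with `ν ≱ μ`. That this is the same
notion is proved in `isJackFamily_iff`; `IsJack.unique` shows that at most one `f` has the property. -/
def IsJack (μ : YoungDiagram) (f : SymFun) : Prop :=
  toSeries f - m μ ∈ Submodule.span F (m '' {ν | DomLT ν μ}) ∧
    ∀ g : SymFun, toSeries g ∈ Submodule.span F (m '' {ν | ¬ DomLE μ ν}) → scalar f g = 0

/-- The Jack function `P_μ(α)`. By `IsJackFamily.eq_P`, any family with the defining property
`IsJackFamily` is the family `P`. -/
noncomputable def P (μ : YoungDiagram) : SymFun := Classical.epsilon (IsJack μ)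

/-- The dual Jack function `Q_μ(α) = ⟨P_μ, P_μ⟩⁻¹ P_μ(α)`. -/
noncomputable def Q (μ : YoungDiagram) : SymFun := (scalar (P μ) (P μ))⁻¹ • P μ

/-- The coefficient of `m_{(1ⁿ)}` in a symmetric function, i.e. the coefficient of the monomial
`x₀ x₁ ⋯ x_{n-1}`. -/
noncomputable def coeffOnes (n : ℕ) (f : SymFun) : F :=
  MvPowerSeries.coeff (∑ i ∈ Finset.range n, Finsupp.single i 1) (toSeries f)

/-- The Jack function `J_μ(α)`: the multiple of `P_μ(α)` in which `m_{(1ⁿ)}`, `n = |μ|`, has the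
coefficient `n!`. -/
noncomputable def J (μ : YoungDiagram) : SymFun :=
  ((μ.card.factorial : F) / coeffOnes μ.card (P μ)) • P μ

/-- The exponent of the monomial `p_κ` of a partition `κ` of `n`. -/
noncomputable def pExponent {n : ℕ} (κ : n.Partition) : ℕ+ →₀ ℕ :=
  Multiset.toFinsupp (κ.parts.map Nat.toPNat')

/-- The one-row function `q_n(α) = ∑_{κ ⊢ n} α ^ (-l(κ)) z_κ⁻¹ p_κ`. -/
noncomputable def qRow (n : ℕ) : SymFun :=
  ∑ κ : n.Partition, MvPolynomial.monomial (pExponent κ) (weight (pExponent κ))⁻¹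

/-- The generalized homogeneous symmetric function `q_μ(α) = q_{μ₁}(α) q_{μ₂}(α) ⋯`. -/
noncomputable def q (μ : YoungDiagram) : SymFun := (μ.rowLens.map qRow).prod

/-- The coefficients `a_i(α)`, with `a₀(α) = 1`. -/
noncomputable def aCoeff (a i : ℕ) : F :=
  if i = 0 then 1 else
    (-1) ^ i * ((a : F) + 2 * i) *
      ((∏ j ∈ Finset.Icc 1 (i - 1), ((a : F) + j)) / (i.factorial : F)) *
      ((∏ j ∈ Finset.Icc 1 (i - 1), (1 - (j : F) * α)) /
        ∏ j ∈ Finset.Icc 1 i, (1 + ((a : F) + j) * α))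

/-- The coefficients `b_k(α)`, for `2 * k ≤ s + r`. -/
noncomputable def bCoeff (r s k : ℕ) : F :=
  ((s + r - 2 * k).factorial : F) *
    ∏ j ∈ Finset.Icc 1 k, ((s : F) + 1 - j) * (α + r + 1 - j)

/-! ### The power sums are algebraically independent -/

theorem coeff_powerSumSeries_mul (k : ℕ+) (G : MvPowerSeries ℕ F) (e : ℕ →₀ ℕ) :
    MvPowerSeries.coeff e (powerSumSeries k * G) =
      ∑ i ∈ e.support, if (k : ℕ) ≤ e i then
        MvPowerSeries.coeff (e - Finsupp.single i (k : ℕ)) G else 0 := by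
  classical
  rw [MvPowerSeries.coeff_mul]
  symm
  rw [← Finset.sum_filter]
  refine Finset.sum_of_injOn (fun i => (Finsupp.single i (k : ℕ), e - Finsupp.single i (k : ℕ)))
    ?_ ?_ ?_ ?_
  · intro i _ j _ h
    have h1 : Finsupp.single i (k : ℕ) = Finsupp.single j (k : ℕ) := congrArg Prod.fst h
    exact Finsupp.single_left_injective k.pos.ne' h1
  · intro i hi
    have hi' : (k : ℕ) ≤ e i := by
      have := Finset.mem_coe.1 hi
      exact (Finset.mem_filter.1 this).2
    simp only [Finset.mem_coe, Finset.HasAntidiagonal.mem_antidiagonal]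
    exact add_tsub_cancel_of_le (Finsupp.single_le_iff.2 hi')
  · rintro ⟨x, y⟩ hxy hn
    rw [Finset.HasAntidiagonal.mem_antidiagonal] at hxy
    have : MvPowerSeries.coeff x (powerSumSeries k) = 0 := by
      change (if ∃ i, x = Finsupp.single i (k : ℕ) then (1 : F) else 0) = 0
      rw [if_neg]
      rintro ⟨i, rfl⟩
      apply hn
      refine ⟨i, ?_, ?_⟩
      · have hk : (k : ℕ) ≤ e i := by rw [← hxy]; simp
        simp only [Finset.coe_filter, Set.mem_ofPred_eq, Finsupp.mem_support_iff]
        exact ⟨by have := k.pos; omega, hk⟩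
      · simp [← hxy]
    simp [this]
  · intro i _
    have : MvPowerSeries.coeff (Finsupp.single i (k : ℕ)) (powerSumSeries k) = 1 := by
      change (if ∃ j, Finsupp.single i (k : ℕ) = Finsupp.single j (k : ℕ) then (1 : F) else 0) = 1
      rw [if_pos ⟨i, rfl⟩]
    simp [this]

theorem map_support_erase {e : ℕ →₀ ℕ} {i : ℕ} (hi : i ∈ e.support) :
    e.support.val.map e = e i ::ₘ (e.erase i).support.val.map (e.erase i) := by
  classical
  rw [Finsupp.support_erase, ← Finset.insert_erase hi,
    Finset.insert_val_of_notMem (Finset.notMem_erase i _), Multiset.map_cons,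
    Finset.erase_insert (Finset.notMem_erase i _)]
  congr 1
  refine Multiset.map_congr rfl ?_
  intro j hj
  have : j ≠ i := Finset.ne_of_mem_erase (s := e.support) hj
  rw [Finsupp.erase_ne this]

theorem sub_single_eq_erase {e : ℕ →₀ ℕ} {i k : ℕ} (h : e i = k) :
    e - Finsupp.single i k = e.erase i := by
  classical
  ext j
  by_cases hj : j = i
  · subst hj; simp [h]
  · simp [Finsupp.erase_ne hj, Ne.symm hj]

theorem coeff_prod_powerSumSeries (s : Multiset ℕ+) (e : ℕ →₀ ℕ) :
    ∃ n : ℕ, MvPowerSeries.coeff e (s.map powerSumSeries).prod = (n : F) ∧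
      (e.support.val.map e = s.map PNat.val → n ≠ 0) ∧
      (n ≠ 0 → e.support.card ≤ s.card ∧
        (e.support.card = s.card → e.support.val.map e = s.map PNat.val)) := by
  classical
  induction s using Multiset.induction_on generalizing e with
  | empty =>
    refine ⟨if e = 0 then 1 else 0, ?_, ?_, ?_⟩
    · simp [MvPowerSeries.coeff_one]
    · intro h
      have : e = 0 := by simpa using h
      simp [this]
    · intro h
      have : e = 0 := by by_contra h'; simp [h'] at h
      simp [this]
  | cons k s ih =>
    choose N h1 h2 h3 using ih
    refine ⟨∑ i ∈ e.support, if (k : ℕ) ≤ e i then N (e - Finsupp.single i (k : ℕ)) else 0,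
      ?_, ?_, ?_⟩
    · rw [Multiset.map_cons, Multiset.prod_cons, coeff_powerSumSeries_mul]
      push_cast
      exact Finset.sum_congr rfl fun i _ => by rw [h1]
    · intro h hs
      have hk : (k : ℕ) ∈ e.support.val.map e := by rw [h]; simp
      obtain ⟨i, hi, hik⟩ := Multiset.mem_map.1 hk
      have hi' : i ∈ e.support := hi
      have h0 := (Finset.sum_eq_zero_iff.1 hs) i hi'
      rw [if_pos hik.ge, sub_single_eq_erase hik] at h0
      refine h2 _ ?_ h0
      rw [map_support_erase hi', hik, Multiset.map_cons] at h
      exact (Multiset.cons_inj_right _).1 h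
    · intro hs
      obtain ⟨i, hi, h0⟩ := Finset.exists_ne_zero_of_sum_ne_zero hs
      have hk : (k : ℕ) ≤ e i := by
        by_contra hk
        simp [hk] at h0
      rw [if_pos hk] at h0
      obtain ⟨h4, h5⟩ := h3 _ h0
      have hcard := Finset.card_erase_add_one hi
      rcases hk.eq_or_lt with hk | hk
      · rw [sub_single_eq_erase hk.symm] at h4 h5
        have hc : (e.erase i).support.card + 1 = e.support.card := by
          rw [Finsupp.support_erase, hcard]
        rw [Multiset.card_cons]
        refine ⟨by omega, fun h => ?_⟩
        rw [map_support_erase hi, h5 (by omega), Multiset.map_cons, hk]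
      · have hsup : e.support ⊆ (e - Finsupp.single i (k : ℕ)).support := by
          intro j hj
          rw [Finsupp.mem_support_iff] at hj ⊢
          by_cases hj' : j = i
          · subst hj'; simp; omega
          · simpa [Finsupp.single_apply, Ne.symm hj'] using hj
        have := Finset.card_le_card hsup
        rw [Multiset.card_cons]
        exact ⟨by omega, fun h => by omega⟩

theorem exists_exponent (s : Multiset ℕ+) :
    ∃ e : ℕ →₀ ℕ, e.support.val.map e = s.map PNat.val := by
  classical
  induction s using Multiset.induction_on with
  | empty => exact ⟨0, by simp⟩
  | cons k s ih =>
    obtain ⟨e, he⟩ := ih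
    obtain ⟨i, hi⟩ := Infinite.exists_notMem_finset e.support
    have hi0 : e i = 0 := Finsupp.notMem_support_iff.1 hi
    have hi' : i ∈ (e + Finsupp.single i (k : ℕ)).support := by
      simp [hi0]
    refine ⟨e + Finsupp.single i (k : ℕ), ?_⟩
    have hE : (e + Finsupp.single i (k : ℕ)).erase i = e := by
      ext j
      by_cases hj : j = i
      · subst hj; simp [hi0]
      · simp [Finsupp.erase_ne hj]
    rw [map_support_erase hi', hE, he, Multiset.map_cons]
    simp [hi0]

theorem toSeries_monomial (d : ℕ+ →₀ ℕ) (c : F) :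
    toSeries (MvPolynomial.monomial d c) =
      c • ((Finsupp.toMultiset d).map powerSumSeries).prod := by
  rw [toSeries, MvPolynomial.aeval_monomial, Algebra.smul_def, Finsupp.toMultiset_map,
    Finsupp.prod_toMultiset]
  congr 1
  rw [Finsupp.prod_mapDomain_index] <;> simp [pow_add]

theorem toSeries_injective : Function.Injective toSeries := by
  classical
  rw [injective_iff_map_eq_zero]
  intro f hf
  by_contra hne
  obtain ⟨d, hd, hmax⟩ := f.support.exists_max_image (fun d => (Finsupp.toMultiset d).card)
    (MvPolynomial.support_nonempty.2 hne)
  obtain ⟨e, he⟩ := exists_exponent (Finsupp.toMultiset d)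
  have hec : e.support.card = (Finsupp.toMultiset d).card := by
    have := congrArg Multiset.card he
    simpa only [Multiset.card_map, Finset.card_val] using this
  have hsum : MvPowerSeries.coeff e (toSeries f) = ∑ d' ∈ f.support,
      f.coeff d' * MvPowerSeries.coeff e ((Finsupp.toMultiset d').map powerSumSeries).prod := by
    conv_lhs => rw [f.as_sum, map_sum, map_sum]
    refine Finset.sum_congr rfl fun d' _ => ?_
    rw [toSeries_monomial, map_smul, smul_eq_mul]
  rw [hf, map_zero, Finset.sum_eq_single d] at hsum
  · obtain ⟨n, hn, hn0, -⟩ := coeff_prod_powerSumSeries (Finsupp.toMultiset d) e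
    rw [hn] at hsum
    have := hn0 he
    rcases mul_eq_zero.1 hsum.symm with h | h
    · exact (MvPolynomial.mem_support_iff.1 hd) h
    · exact this (by exact_mod_cast h)
  · intro d' hd' hdd
    obtain ⟨n, hn, -, hn0⟩ := coeff_prod_powerSumSeries (Finsupp.toMultiset d') e
    rw [hn]
    by_cases h0 : n = 0
    · simp [h0]
    · exfalso
      obtain ⟨h1, h2⟩ := hn0 h0
      have h3 := hmax d' hd'
      have h4 := h2 (by omega)
      rw [he] at h4
      have h5 : Finsupp.toMultiset d = Finsupp.toMultiset d' :=
        Multiset.map_injective PNat.coe_injective h4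
      exact hdd (by simpa using (congrArg Multiset.toFinsupp h5).symm)
  · intro h
    exact absurd hd h

/-! ### The scalar product is bilinear and symmetric -/

theorem scalar_eq_sum {f : SymFun} (g : SymFun) {S : Finset (ℕ+ →₀ ℕ)} (h : f.support ⊆ S) :
    scalar f g = ∑ d ∈ S, f.coeff d * g.coeff d * weight d := by
  refine Finset.sum_subset h fun d _ hd => ?_
  rw [MvPolynomial.notMem_support_iff.1 hd, zero_mul, zero_mul]

theorem scalar_comm (f g : SymFun) : scalar f g = scalar g f := by
  classical
  rw [scalar_eq_sum g (Finset.subset_union_left (s₂ := g.support)),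
    scalar_eq_sum f (Finset.subset_union_right (s₁ := f.support))]
  exact Finset.sum_congr rfl fun d _ => by ring

theorem scalar_add_right (f g h : SymFun) : scalar f (g + h) = scalar f g + scalar f h := by
  simp only [scalar, MvPolynomial.coeff_add, ← Finset.sum_add_distrib]
  exact Finset.sum_congr rfl fun d _ => by ring

theorem scalar_smul_right (f g : SymFun) (c : F) : scalar f (c • g) = c * scalar f g := by
  simp only [scalar, MvPolynomial.coeff_smul, smul_eq_mul, Finset.mul_sum]
  exact Finset.sum_congr rfl fun d _ => by ring

theorem scalar_sub_left (f g h : SymFun) : scalar (f - g) h = scalar f h - scalar g h := by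
  rw [scalar_comm (f - g), scalar_comm f, scalar_comm g, sub_eq_add_neg,
    ← neg_one_smul F g, scalar_add_right, scalar_smul_right]
  ring

theorem scalar_zero_right (f : SymFun) : scalar f 0 = 0 := by simp [scalar]

theorem eq_zero_of_scalar_self {f : SymFun} (h : scalar f f = 0) : f = 0 := by
  classical
  obtain ⟨b, hb⟩ := IsLocalization.exist_integer_multiples_of_finset
    (nonZeroDivisors (Polynomial ℚ)) (f.support.image f.coeff)
  have hb' : ∀ d ∈ f.support, ∃ c : Polynomial ℚ,
      algebraMap (Polynomial ℚ) F c = algebraMap (Polynomial ℚ) F b * f.coeff d := by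
    intro d hd
    obtain ⟨c, hc⟩ := hb _ (Finset.mem_image_of_mem _ hd)
    exact ⟨c, by rw [hc, Algebra.smul_def]⟩
  choose! c hc using hb'
  have hbne : algebraMap (Polynomial ℚ) F b ≠ 0 :=
    (map_ne_zero_iff _ (IsFractionRing.injective (Polynomial ℚ) F)).2 (nonZeroDivisors.ne_zero b.2)
  let w : (ℕ+ →₀ ℕ) → ℚ := fun d => d.prod fun k n => ((k : ℕ) : ℚ) ^ n * (n.factorial : ℚ)
  have hwpos : ∀ d, 0 < w d := fun d => Finset.prod_pos fun k _ => by
    have := k.pos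
    have := Nat.factorial_pos (d k)
    positivity
  have hw : ∀ d, weight d =
      algebraMap (Polynomial ℚ) F (Polynomial.X ^ d.degree * Polynomial.C (w d)) := by
    intro d
    simp only [weight, w, Finsupp.prod, map_mul, map_pow, map_prod, RatFunc.algebraMap_X, map_natCast]
  have hpoly : ∑ d ∈ f.support, c d * c d * (Polynomial.X ^ d.degree * Polynomial.C (w d)) = 0 := by
    apply IsFractionRing.injective (Polynomial ℚ) F
    rw [map_sum, map_zero]
    calc _ = ∑ d ∈ f.support, algebraMap (Polynomial ℚ) F b ^ 2 *
          (f.coeff d * f.coeff d * weight d) := by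
          refine Finset.sum_congr rfl fun d hd => ?_
          rw [map_mul, map_mul, hc d hd, ← hw]
          ring
      _ = 0 := by
          rw [← Finset.mul_sum]
          change _ * scalar f f = 0
          rw [h, mul_zero]
  by_contra hne
  obtain ⟨d, hd⟩ := MvPolynomial.support_nonempty.2 hne
  have hcd : c d = 0 := by
    refine Polynomial.eq_zero_of_infinite_isRoot _ ((Set.Ioi_infinite (0 : ℚ)).mono ?_)
    intro t ht
    have ht' : 0 < t := ht
    have h1 := congrArg (Polynomial.eval t) hpoly
    simp only [Polynomial.eval_finsetSum, Polynomial.eval_mul, Polynomial.eval_pow,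
      Polynomial.eval_X, Polynomial.eval_C, Polynomial.eval_zero] at h1
    have h2 := (Finset.sum_eq_zero_iff_of_nonneg fun e _ =>
      mul_nonneg (mul_self_nonneg _) (mul_pos (pow_pos ht' _) (hwpos e)).le).1 h1 d hd
    rcases mul_eq_zero.1 h2 with h3 | h3
    · exact mul_self_eq_zero.1 h3
    · exact absurd h3 (mul_pos (pow_pos ht' _) (hwpos d)).ne'
  have h4 := hc d hd
  rw [hcd, map_zero] at h4
  rcases mul_eq_zero.1 h4.symm with h5 | h5
  · exact hbne h5
  · exact MvPolynomial.mem_support_iff.1 hd h5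

/-! ### The dominance ordering is a locally finite partial order -/

theorem DomLE.refl (μ : YoungDiagram) : DomLE μ μ := ⟨rfl, fun _ => le_rfl⟩

theorem DomLE.trans {μ ν κ : YoungDiagram} (h : DomLE μ ν) (h' : DomLE ν κ) : DomLE μ κ :=
  ⟨h.1.trans h'.1, fun k => (h.2 k).trans (h'.2 k)⟩

theorem DomLE.antisymm {μ ν : YoungDiagram} (h : DomLE μ ν) (h' : DomLE ν μ) : μ = ν := by
  have hs : ∀ k, ∑ i ∈ Finset.range k, μ.rowLen i = ∑ i ∈ Finset.range k, ν.rowLen i :=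
    fun k => le_antisymm (h.2 k) (h'.2 k)
  have hr : ∀ i, μ.rowLen i = ν.rowLen i := fun i => by
    have := hs (i + 1)
    rw [Finset.sum_range_succ, Finset.sum_range_succ, hs i] at this
    omega
  ext ⟨i, j⟩
  rw [YoungDiagram.mem_cells, YoungDiagram.mem_cells, YoungDiagram.mem_iff_lt_rowLen,
    YoungDiagram.mem_iff_lt_rowLen, hr]

theorem finite_card_eq (n : ℕ) : {μ : YoungDiagram | μ.card = n}.Finite := by
  refine Set.Finite.of_finite_image (f := YoungDiagram.cells)
    ((Finset.finite_toSet (Finset.range n ×ˢ Finset.range n).powerset).subset ?_) ?_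
  · rintro _ ⟨μ, hμ, rfl⟩
    rw [Finset.mem_coe, Finset.mem_powerset]
    rintro ⟨i, j⟩ hc
    have hc' : (i, j) ∈ μ := hc
    have hrow : j < μ.rowLen i := YoungDiagram.mem_iff_lt_rowLen.1 hc'
    have hcol : i < μ.colLen j := YoungDiagram.mem_iff_lt_colLen.1 hc'
    have h1 : μ.rowLen i ≤ μ.card := by
      rw [YoungDiagram.rowLen_eq_card]
      exact Finset.card_le_card (Finset.filter_subset _ _)
    have h2 : μ.colLen j ≤ μ.card := by
      rw [YoungDiagram.colLen_eq_card]
      exact Finset.card_le_card (Finset.filter_subset _ _)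
    have hμ' : μ.card = n := hμ
    simp only [Finset.mem_product, Finset.mem_range]
    omega
  · intro μ _ ν _ h
    exact YoungDiagram.ext h

theorem m_mem_span {P : YoungDiagram → SymFun}
    (hP : ∀ μ, toSeries (P μ) - m μ ∈ Submodule.span F (m '' {ν | DomLT ν μ})) (μ : YoungDiagram) :
    m μ ∈ Submodule.span F ((fun ν => toSeries (P ν)) '' {ν | DomLE ν μ}) := by
  induction hN : {ν | DomLE ν μ}.ncard using Nat.strong_induction_on generalizing μ with
  | _ N ih =>
    have hle : Submodule.span F (m '' {ν | DomLT ν μ}) ≤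
        Submodule.span F ((fun ν => toSeries (P ν)) '' {ν | DomLE ν μ}) := by
      rw [Submodule.span_le]
      rintro _ ⟨ν, hν, rfl⟩
      have hν' : DomLT ν μ := hν
      have hsub : {κ | DomLE κ ν} ⊆ {κ | DomLE κ μ} := fun κ hκ => DomLE.trans hκ hν'.1
      have hlt : {κ | DomLE κ ν}.ncard < N := by
        rw [← hN]
        refine Set.ncard_lt_ncard ⟨hsub, fun h => ?_⟩ ((finite_card_eq μ.card).subset fun κ hκ => hκ.1)
        exact hν'.2 (hν'.1.antisymm (h (DomLE.refl μ)))
      exact Submodule.span_mono (Set.image_mono hsub) (ih _ hlt ν rfl)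
    have h1 : toSeries (P μ) ∈ Submodule.span F ((fun ν => toSeries (P ν)) '' {ν | DomLE ν μ}) :=
      Submodule.subset_span ⟨μ, DomLE.refl μ, rfl⟩
    have h2 := Submodule.sub_mem _ h1 (hle (hP μ))
    rwa [sub_sub_cancel] at h2

/-- A family of symmetric functions is the family of Jack functions if and only if each member has the
property that defines the corresponding Jack function `P μ`. -/
theorem isJackFamily_iff (P : YoungDiagram → SymFun) :
    IsJackFamily P ↔ ∀ μ, IsJack μ (P μ) := by
  constructor
  · rintro ⟨hP, horth⟩ μ
    refine ⟨hP μ, fun g hg => ?_⟩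
    have hle : Submodule.span F (m '' {ν | ¬ DomLE μ ν}) ≤
        (Submodule.span F (P '' {ν | ¬ DomLE μ ν})).map toSeries.toLinearMap := by
      rw [Submodule.span_le]
      rintro _ ⟨ν, hν, rfl⟩
      rw [Submodule.map_span, ← Set.image_comp]
      refine Submodule.span_mono (Set.image_mono ?_) (m_mem_span hP ν)
      intro κ hκ h
      exact hν (DomLE.trans h hκ)
    obtain ⟨g', hg', hgg⟩ := hle hg
    have : g' = g := toSeries_injective hgg
    subst this
    clear hgg hg
    induction hg' using Submodule.span_induction with
    | mem x hx =>
      obtain ⟨ν, hν, rfl⟩ := hx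
      refine horth _ _ ?_
      rintro rfl
      exact hν (DomLE.refl _)
    | zero => exact scalar_zero_right _
    | add x y _ _ hx hy => rw [scalar_add_right, hx, hy, add_zero]
    | smul c x _ hx => rw [scalar_smul_right, hx, mul_zero]
  · intro h
    have key : ∀ μ ν, ¬ DomLE μ ν → scalar (P μ) (P ν) = 0 := by
      intro μ ν hμν
      refine (h μ).2 _ ?_
      have h1 : m ν ∈ Submodule.span F (m '' {κ | ¬ DomLE μ κ}) :=
        Submodule.subset_span ⟨ν, hμν, rfl⟩
      have h2 : toSeries (P ν) - m ν ∈ Submodule.span F (m '' {κ | ¬ DomLE μ κ}) := by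
        refine Submodule.span_mono (Set.image_mono ?_) (h ν).1
        intro κ hκ hc
        exact hμν (DomLE.trans hc hκ.1)
      have h3 := Submodule.add_mem _ h2 h1
      rwa [sub_add_cancel] at h3
    refine ⟨fun μ => (h μ).1, fun μ ν hne => ?_⟩
    by_cases hμν : DomLE μ ν
    · rw [scalar_comm]
      exact key ν μ fun hc => hne (hμν.antisymm hc)
    · exact key μ ν hμν

theorem IsJack.unique {μ : YoungDiagram} {f g : SymFun} (hf : IsJack μ f) (hg : IsJack μ g) :
    f = g := by
  have h1 : toSeries (f - g) ∈ Submodule.span F (m '' {ν | DomLT ν μ}) := by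
    have := Submodule.sub_mem _ hf.1 hg.1
    rwa [sub_sub_sub_cancel_right, ← map_sub] at this
  have h2 : toSeries (f - g) ∈ Submodule.span F (m '' {ν | ¬ DomLE μ ν}) :=
    Submodule.span_mono (Set.image_mono fun ν hν hc => hν.2 (hν.1.antisymm hc)) h1
  refine sub_eq_zero.1 (eq_zero_of_scalar_self ?_)
  rw [scalar_sub_left, hf.2 _ h2, hg.2 _ h2, sub_zero]

/-- Every Jack family consists of the functions `P μ`. -/
theorem IsJackFamily.eq_P {R : YoungDiagram → SymFun} (hR : IsJackFamily R) : R = P := by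
  funext μ
  have h := (isJackFamily_iff R).1 hR μ
  exact h.unique (Classical.epsilon_spec ⟨_, h⟩)

end Jack

namespace Jack

open Finset

section WellPoised

variable {K : Type*} [Field K]

/-! By `coeff_toSeries` the products q_μ form the dual basis of the m_μ: pairing with q_μ reads off
the coefficient of m_μ. Let T = Σ a_i q_{r+i} q_{s-i}. It is orthogonal to every m_ν with ν not of
the form (r+i, s-i), and all these dominate (r, s), so the orthogonality half of `IsJack` is free.
What remains is that no m_ν with ν₁ > r occurs in T, and this follows once T is orthogonal to all
multiples of q_N for N > r. That is `scalar_twoRowSum_mul_eq_zero`, the heart of the proof.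

Pairing with q_u q_v takes the coefficient of x^u y^v in two variables (`coeff_restrict₂`), where
q_N becomes Σ_{u+v=N} γ_u γ_v x^u y^v, with γ the coefficients of (1-t)^{-θ} and θ = 1/α. Hence ⟨T,
q_N f⟩ = Σ_{c+d=r+s-N} f_{cd} R(c,d), where R(c,d) = Σ a_i γ_{r+i-c} γ_{s-i-d}. Since f_{cd} is
symmetric in c and d, it suffices that R(c,d) + R(d,c) = 0 for c+d < s
(`rowSum_add_rowSum_eq_zero`). At c = d = 0 this is a very-well-poised sum that telescopes;
contiguous relations between the a_i for neighbouring values of a carry it to all c+d by induction.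

For two columns, the scaling p_k ↦ (-1)^{k-1} α p_k is self-adjoint and sends q_n to e_n. The same
vanishing theorem, now with θ = α, shows that Σ a_i e_{r+i} e_{s-i} (coefficients taken at θ = α) is
orthogonal to all multiples of e_n for n > r, hence to all m_ν with more than r parts; every ν of
weight r+s that does not dominate the two-column shape is among them. Its expansion in the m_μ has
coefficients Σ_j a_j·binomial, which `binomSum_eq` evaluates in closed form; rescaling them gives
the b_k. -/

/-- The very-well-poised coefficients with parameter `θ`, given by their term ratio. -/
noncomputable def wellPoised (θ : K) (a : ℕ) : ℕ → K
  | 0 => 1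
  | 1 => -((a + 2) * θ) / (a + 1 + θ)
  | i + 2 => wellPoised θ a (i + 1) *
      ((a + 2 * i + 4) * (a + i + 1) * (i + 1 - θ) / ((a + 2 * i + 2) * (i + 2) * (a + i + 2 + θ)))

/-! ### Contiguous relations of the well-poised coefficients -/

variable {θ : K}

/-- Raising a by one changes a coefficient by an explicit rational factor, because both sides have
rational term ratios in i. It expresses all coefficients of a contiguous relation as multiples of a
single one. -/
theorem wellPoised_shift [CharZero K] (hθ : ∀ n : ℕ, (n : K) + θ ≠ 0) (a i : ℕ) :
    wellPoised θ (a + 1) (i + 1) = wellPoised θ a (i + 1) *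
      ((a + 2 * i + 3) * (a + i + 1) * (a + 1 + θ) /
        ((a + 2 * i + 2) * (a + 1) * (a + i + 2 + θ))) := by
  induction i with
  | zero =>
    have h1 := hθ (a + 1)
    have h2 := hθ (a + 2)
    have h3 : (a : K) + 1 ≠ 0 := by exact_mod_cast Nat.succ_ne_zero a
    have h4 : (a : K) + 2 ≠ 0 := by exact_mod_cast Nat.succ_ne_zero (a + 1)
    push_cast at h1 h2
    have h5 : (a : K) + 1 + 1 + θ ≠ 0 := by convert h2 using 2; ring
    simp only [wellPoised]
    push_cast
    simp only [mul_zero, add_zero]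
    field_simp
    ring
  | succ i ih =>
    have h1 := hθ (a + 1)
    have h2 := hθ (a + i + 2)
    have h2' := hθ (a + i + 3)
    have h3 : (a : K) + 1 ≠ 0 := by exact_mod_cast Nat.succ_ne_zero a
    have h4 : (a : K) + 2 * i + 2 ≠ 0 := by exact_mod_cast Nat.succ_ne_zero (a + 2 * i + 1)
    have h5 : (a : K) + 2 * i + 3 ≠ 0 := by exact_mod_cast Nat.succ_ne_zero (a + 2 * i + 2)
    have h6 : (a : K) + 2 * i + 4 ≠ 0 := by exact_mod_cast Nat.succ_ne_zero (a + 2 * i + 3)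
    have h7 : (i : K) + 2 ≠ 0 := by exact_mod_cast Nat.succ_ne_zero (i + 1)
    push_cast at h1 h2 h2'
    rw [wellPoised, ih, wellPoised]
    push_cast
    rw [show (a : K) + 1 + 2 * i + 2 = a + 2 * i + 3 by ring,
      show (a : K) + 1 + i + 2 + θ = a + i + 3 + θ by ring,
      show (a : K) + (i + 1) + 2 + θ = a + i + 3 + θ by ring,
      show (a : K) + 2 * (i + 1) + 2 = a + 2 * i + 4 by ring]
    field_simp
    ring

/-- By `wellPoised_shift` every term is a rational multiple of `wellPoised θ a i`, for i ≥ 1, which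
leaves a rational identity. The index 0 is treated by hand, since the shift covers positive indices
only. -/
theorem wellPoised_three_term [CharZero K] (hθ : ∀ n : ℕ, (n : K) + θ ≠ 0) (a i : ℕ) :
    wellPoised θ (a + 1) (i + 1) + wellPoised θ (a + 1) i =
      (a + 2) * (a + 1 + 2 * θ) / ((a + 1 + θ) * (a + 2 + θ)) * wellPoised θ (a + 2) i +
        wellPoised θ a (i + 1) := by
  rcases i with _ | i
  · have h1 := hθ (a + 1)
    have h2 := hθ (a + 2)
    push_cast at h1 h2
    simp only [wellPoised]
    push_cast
    rw [show (a : K) + 1 + 1 + θ = a + 2 + θ by ring]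
    field_simp
    ring
  · have h1 := hθ (a + 1)
    have h1' := hθ (a + 2)
    have h2 := hθ (a + i + 2)
    have h2' := hθ (a + i + 3)
    have h3 : (a : K) + 1 ≠ 0 := by exact_mod_cast Nat.succ_ne_zero a
    have h3' : (a : K) + 2 ≠ 0 := by exact_mod_cast Nat.succ_ne_zero (a + 1)
    have h4 : (a : K) + 2 * i + 2 ≠ 0 := by exact_mod_cast Nat.succ_ne_zero (a + 2 * i + 1)
    have h5 : (a : K) + 2 * i + 3 ≠ 0 := by exact_mod_cast Nat.succ_ne_zero (a + 2 * i + 2)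
    have h6 : (a : K) + 2 * i + 4 ≠ 0 := by exact_mod_cast Nat.succ_ne_zero (a + 2 * i + 3)
    have h7 : (i : K) + 2 ≠ 0 := by exact_mod_cast Nat.succ_ne_zero (i + 1)
    push_cast at h1 h1' h2 h2'
    rw [wellPoised_shift hθ (a + 1) i, wellPoised_shift hθ a i, wellPoised_shift hθ a (i + 1),
      wellPoised]
    push_cast
    rw [show (a : K) + 1 + 2 * i + 2 = a + 2 * i + 3 by ring,
      show (a : K) + 1 + 1 = a + 2 by ring,
      show (a : K) + 1 + i + 2 + θ = a + i + 3 + θ by ring,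
      show (a : K) + (i + 1) + 2 + θ = a + i + 3 + θ by ring,
      show (a : K) + 2 * (i + 1) + 2 = a + 2 * i + 4 by ring]
    field_simp
    ring

/-- This is the three-term relation at the formal value a = -1: the recursion there gives -1 at
index 1 and 0 at all later ones, which is the Kronecker term. -/
theorem wellPoised_three_term_zero [CharZero K] (hθ : ∀ n : ℕ, (n : K) + θ ≠ 0) (i : ℕ) :
    wellPoised θ 0 (i + 1) + wellPoised θ 0 i + (if i = 0 then 1 else 0) =
      2 / (1 + θ) * wellPoised θ 1 i := by
  rcases i with _ | i
  · have h1 := hθ 1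
    push_cast at h1
    simp only [wellPoised]
    push_cast
    simp only [zero_add]
    field_simp
    ring
  · have h1 := hθ 1
    have h2 := hθ (i + 2)
    have h4 : 2 * (i : K) + 2 ≠ 0 := by exact_mod_cast Nat.succ_ne_zero (2 * i + 1)
    have h7 : (i : K) + 2 ≠ 0 := by exact_mod_cast Nat.succ_ne_zero (i + 1)
    have h8 : (i : K) + 1 ≠ 0 := by exact_mod_cast Nat.succ_ne_zero i
    push_cast at h1 h2
    rw [wellPoised_shift hθ 0 i, wellPoised]
    push_cast
    simp only [zero_add, add_zero]
    field_simp
    ring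

/-! ### The telescoping very-well-poised sum -/

/-- `γ` is the sequence of the coefficients of `(1 - t) ^ (-θ)`. -/
def IsRising (θ : K) (γ : ℕ → K) : Prop :=
  γ 0 = 1 ∧ ∀ n : ℕ, (n + 1 : K) * γ (n + 1) = (θ + n) * γ n

/-- The induction step of `wellPoised_partial_sum`, with w, G, H standing for the coefficient and
the two values of γ. -/
theorem partial_sum_step {a k M : K} (h0 : θ ≠ 0) (h5 : M + 1 ≠ 0) (h8 : a + 2 * k + 2 ≠ 0)
    (h9 : k + 2 ≠ 0) (h10 : M + k + 2 ≠ 0) (h1 : a + k + 2 + θ ≠ 0) (h6 : a + M + 2 * k + 4 ≠ 0)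
    (hM : θ + a + M + k + 2 ≠ 0) (w G H : K) :
    (w * (G * ((θ + M) * H / (M + 1))) * ((a + k + 1) * (k + 1 - θ) *
            (θ + a + M + k + 2 + k + 1) * -(M + 1)) /
          ((a + 2 * k + 2) * θ * (M + k + 2) * (θ + a + M + k + 2)) +
        w * ((a + 2 * k + 4) * (a + k + 1) * (k + 1 - θ) /
            ((a + 2 * k + 2) * (k + 2) * (a + k + 2 + θ))) *
          ((θ + a + M + 2 * k + 3) * G / (a + M + 2 * k + 4) * H)) *
      ((a + 2 * k + 4) * θ * (M + k + 2) * (θ + a + M + k + 2)) =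
    w * ((a + 2 * k + 4) * (a + k + 1) * (k + 1 - θ) /
          ((a + 2 * k + 2) * (k + 2) * (a + k + 2 + θ))) *
        ((θ + a + M + 2 * k + 3) * G / (a + M + 2 * k + 4) * H) *
      ((a + k + 2) * (k + 1 + 1 - θ) * (θ + a + M + k + 2 + (k + 1) + 1) * -M) := by
  -- With the linear factors as independent atoms, the only arithmetic needed is the relation x θ u
  -- v - R = t z z' y; it is checked by `ring` after instantiation.
  have cleared : ∀ p q u v x y z z' e f g t R : K, p ≠ 0 → q ≠ 0 → u ≠ 0 → v ≠ 0 →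
      y ≠ 0 → z ≠ 0 → z' ≠ 0 → x * θ * u * v - R = t * z * z' * y →
      (w * (G * (t * H / p)) * (e * f * g * -p) / (q * θ * u * v) +
        w * (x * e * f / (q * z * z')) * (g * G / y * H)) * (x * θ * u * v) =
      w * (x * e * f / (q * z * z')) * (g * G / y * H) * R := by
    intro p q u v x y z z' e f g t R hp hq hu hv hy hz hz' h
    obtain rfl : R = x * θ * u * v - t * z * z' * y := by rw [← h]; ring
    field_simp
    ring
  have := cleared (M + 1) (a + 2 * k + 2) (M + k + 2) (θ + a + M + k + 2)
    (a + 2 * k + 4) (a + M + 2 * k + 4) (k + 2) (a + k + 2 + θ) (a + k + 1) (k + 1 - θ)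
    (θ + a + M + 2 * k + 3) (θ + M)
    ((a + k + 2) * (k + 1 + 1 - θ) * (θ + a + M + k + 2 + (k + 1) + 1) * -M)
    h5 h8 h10 hM h6 h9 h1 (by ring)
  rw [← this]
  ring

/-- The sum is Gosper-summable: each partial sum is a rational multiple of its last term. The factor
k + 1 - M makes the full sum, k + 1 = M, vanish. -/
theorem wellPoised_partial_sum [CharZero K] (hθ : ∀ n : ℕ, (n : K) + θ ≠ 0) {γ : ℕ → K} (hγ : IsRising θ γ)
    (a M k : ℕ) (hk : k + 1 ≤ M) :
    (∑ i ∈ range (k + 2), wellPoised θ a i * (γ (a + M + i) * γ (M - i))) *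
        ((a + 2 * k + 2) * θ * M * (θ + a + M)) =
      wellPoised θ a (k + 1) * (γ (a + M + (k + 1)) * γ (M - (k + 1))) *
        ((a + k + 1) * (k + 1 - θ) * (θ + a + M + k + 1) * (k + 1 - M)) := by
  have h0 := hθ 0
  simp only [Nat.cast_zero, zero_add] at h0
  induction k with
  | zero =>
    obtain ⟨M, rfl⟩ := Nat.exists_eq_add_of_le' hk
    have h1 := hθ (a + 1)
    have h2 := hθ (a + M + 1)
    have h3 := hθ M
    have g1 := hγ.2 (a + (M + 1))
    have g2 := hγ.2 M
    push_cast at h1 h2 g1 g2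
    have h5 : (M : K) + 1 ≠ 0 := by exact_mod_cast Nat.succ_ne_zero M
    have h6 : (a : K) + M + 2 ≠ 0 := by exact_mod_cast Nat.succ_ne_zero (a + M + 1)
    have e1 : γ (a + (M + 1) + 1) = (θ + (a + (M + 1))) * γ (a + (M + 1)) / (a + M + 2) := by
      rw [eq_div_iff h6, ← g1]; ring
    have e2 : γ (M + 1) = (θ + M) * γ M / (M + 1) := by
      rw [eq_div_iff h5, ← g2]; ring
    simp only [sum_range_succ, sum_range_zero, wellPoised, Nat.sub_zero, Nat.add_sub_cancel,
      zero_add, add_zero, e1]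
    rw [e2]
    push_cast
    field_simp
    ring
  | succ k ih =>
    obtain ⟨M, rfl⟩ := Nat.exists_eq_add_of_le' hk
    have h1 := hθ (a + k + 2)
    have h2 := hθ (a + M + k + 3)
    have h3 := hθ M
    have g1 := hγ.2 (a + (M + (k + 1 + 1)) + (k + 1))
    have g2 := hγ.2 M
    push_cast at h1 h2 g1 g2
    have h5 : (M : K) + 1 ≠ 0 := by exact_mod_cast Nat.succ_ne_zero M
    have h6 : (a : K) + M + 2 * k + 4 ≠ 0 := by exact_mod_cast Nat.succ_ne_zero (a + M + 2 * k + 3)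
    have h8 : (a : K) + 2 * k + 2 ≠ 0 := by exact_mod_cast Nat.succ_ne_zero (a + 2 * k + 1)
    have h9 : (k : K) + 2 ≠ 0 := by exact_mod_cast Nat.succ_ne_zero (k + 1)
    have h10 : (M : K) + k + 2 ≠ 0 := by exact_mod_cast Nat.succ_ne_zero (M + k + 1)
    have e1 : γ (a + (M + (k + 1 + 1)) + (k + 1) + 1) = (θ + a + M + 2 * k + 3) *
        γ (a + (M + (k + 1 + 1)) + (k + 1)) / (a + M + 2 * k + 4) := by
      rw [eq_div_iff h6]; linear_combination g1
    have e2 : γ (M + 1) = (θ + M) * γ M / (M + 1) := by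
      rw [eq_div_iff h5, ← g2]; ring
    have ih' := ih (by omega)
    have hM : (θ + a + ((M + (k + 1 + 1) : ℕ) : K)) ≠ 0 := by
      have := hθ (a + M + k + 2); push_cast at this ⊢
      convert this using 1; ring
    rw [← eq_div_iff (by
      refine mul_ne_zero (mul_ne_zero (mul_ne_zero h8 h0) ?_) hM
      push_cast; convert h10 using 1; ring)] at ih'
    rw [sum_range_succ _ (k + 2), ih', show M + (k + 1 + 1) - (k + 1) = M + 1 by omega,
      show M + (k + 1 + 1) - (k + 1 + 1) = M by omega, ← add_assoc (a + (M + (k + 1 + 1))) (k + 1) 1, e1, e2,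
      wellPoised]
    push_cast at hM ⊢
    have hM' : θ + a + M + k + 2 ≠ 0 := by convert hM using 1; ring
    rw [show θ + (a : K) + (M + (k + 1 + 1)) = θ + a + M + k + 2 by ring,
      show (M : K) + (k + 1 + 1) = M + k + 2 by ring,
      show (k : K) + 1 + 1 - (M + k + 2) = -M by ring,
      show (k : K) + 1 - (M + k + 2) = -(M + 1) by ring,
      show (a : K) + 2 * (k + 1) + 2 = a + 2 * k + 4 by ring,
      show (a : K) + (k + 1) + 1 = a + k + 2 by ring]
    exact partial_sum_step h0 h5 h8 h9 h10 h1 h6 hM' _ _ _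

theorem sum_wellPoised_mul_eq_zero [CharZero K] (hθ : ∀ n : ℕ, (n : K) + θ ≠ 0) {γ : ℕ → K}
    (hγ : IsRising θ γ) (a M : ℕ) (hM : 0 < M) :
    ∑ i ∈ range (M + 1), wellPoised θ a i * (γ (a + M + i) * γ (M - i)) = 0 := by
  obtain ⟨k, rfl⟩ := Nat.exists_eq_add_of_le' hM
  have h := wellPoised_partial_sum hθ hγ a (k + 1) k le_rfl
  have h0 := hθ 0
  simp only [Nat.cast_zero, zero_add] at h0
  have h1 := hθ (a + k + 1)
  have h8 : (a : K) + 2 * k + 2 ≠ 0 := by exact_mod_cast Nat.succ_ne_zero (a + 2 * k + 1)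
  have h9 : (k : K) + 1 ≠ 0 := by exact_mod_cast Nat.succ_ne_zero k
  push_cast at h1 h
  rw [sub_self, mul_zero, mul_zero] at h
  refine (mul_eq_zero.1 h).resolve_right ?_
  refine mul_ne_zero (mul_ne_zero (mul_ne_zero h8 h0) h9) ?_
  convert h1 using 1; ring

/-! ### Antisymmetry of the coefficient sums -/

/-- The coefficient sum `∑ i, a_i γ_{r + i - c} γ_{s - i - d}`. -/
noncomputable def rowSum (θ : K) (γ : ℕ → K) (r s c d : ℕ) : K :=
  ∑ i ∈ range (s - d + 1), wellPoised θ (r - s) i * (γ (r + i - c) * γ (s - d - i))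

theorem rowSum_succ_succ (θ : K) (γ : ℕ → K) (r s c d : ℕ) :
    rowSum θ γ (r + 1) (s + 1) (c + 1) (d + 1) = rowSum θ γ r s c d := by
  unfold rowSum
  rw [Nat.add_sub_add_right, Nat.add_sub_add_right]
  refine sum_congr rfl fun i _ => ?_
  rw [show r + 1 + i - (c + 1) = r + i - c by omega]

theorem sum_wellPoised_three_term [CharZero K] (hθ : ∀ n : ℕ, (n : K) + θ ≠ 0) (h : ℕ → K)
    (a n : ℕ) :
    ∑ i ∈ range (n + 2), wellPoised θ (a + 1) i * h i +
        ∑ i ∈ range (n + 1), wellPoised θ (a + 1) i * h (i + 1) =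
      (a + 2) * (a + 1 + 2 * θ) / ((a + 1 + θ) * (a + 2 + θ)) *
          ∑ i ∈ range (n + 1), wellPoised θ (a + 2) i * h (i + 1) +
        ∑ i ∈ range (n + 2), wellPoised θ a i * h i := by
  rw [sum_range_succ' (fun i => wellPoised θ (a + 1) i * h i),
    sum_range_succ' (fun i => wellPoised θ a i * h i), add_right_comm, ← sum_add_distrib, mul_sum,
    ← add_assoc, ← sum_add_distrib]
  refine congrArg₂ (· + ·) (sum_congr rfl fun i _ => ?_) rfl
  rw [← add_mul, wellPoised_three_term hθ]
  ring

theorem sum_wellPoised_three_term_zero [CharZero K] (hθ : ∀ n : ℕ, (n : K) + θ ≠ 0) (h : ℕ → K)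
    (n : ℕ) :
    ∑ i ∈ range (n + 2), wellPoised θ 0 i * h i +
        ∑ i ∈ range (n + 1), wellPoised θ 0 i * h (i + 1) =
      2 / (1 + θ) * ∑ i ∈ range (n + 1), wellPoised θ 1 i * h (i + 1) + (h 0 - h 1) := by
  have h1 : h 1 = ∑ i ∈ range (n + 1), (if i = 0 then 1 else 0) * h (i + 1) := by
    simp
  rw [h1, sum_range_succ' (fun i => wellPoised θ 0 i * h i), add_right_comm, ← sum_add_distrib,
    mul_sum, add_sub, add_sub_right_comm, ← sum_sub_distrib]
  refine congrArg₂ (· + ·) (sum_congr rfl fun i _ => ?_) (by simp [wellPoised])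
  rw [← mul_assoc, ← wellPoised_three_term_zero hθ]
  ring

/-- With h(i) = γ_{r-1+i-c} γ_{s-d-i}, lowering c or d turns into summing h(i) or h(i+1) against the
same coefficients, so the relation among these carries over. -/
theorem rowSum_three_term [CharZero K] (hθ : ∀ n : ℕ, (n : K) + θ ≠ 0) (γ : ℕ → K) (r s c d : ℕ)
    (h : s < r) (hd : d < s) (hc : c < r) :
    rowSum θ γ r s (c + 1) d + rowSum θ γ r s c (d + 1) =
      ((r - s : ℕ) + 1) * ((r - s : ℕ) + 2 * θ) / (((r - s : ℕ) + θ) * ((r - s : ℕ) + 1 + θ)) *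
        rowSum θ γ r (s - 1) c d + rowSum θ γ (r - 1) s c d := by
  obtain ⟨a, rfl⟩ : ∃ a, r = s + a + 1 := ⟨r - s - 1, by omega⟩
  obtain ⟨k, rfl⟩ : ∃ k, s = d + k + 1 := ⟨s - d - 1, by omega⟩
  have t := sum_wellPoised_three_term hθ
    (fun i => γ (d + k + 1 + a + i - c) * γ (d + k + 1 - d - i)) a k
  unfold rowSum
  rw [show d + k + 1 + a + 1 - (d + k + 1) = a + 1 by omega,
    show d + k + 1 - d + 1 = k + 2 by omega, show d + k + 1 - (d + 1) + 1 = k + 1 by omega,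
    show d + k + 1 + a + 1 - (d + k + 1 - 1) = a + 2 by omega,
    show d + k + 1 - 1 - d + 1 = k + 1 by omega,
    show d + k + 1 + a + 1 - 1 - (d + k + 1) = a by omega]
  have e1 : ∀ i, d + k + 1 + a + 1 + i - (c + 1) = d + k + 1 + a + i - c := fun i => by omega
  have e2 : ∀ i, d + k + 1 + a + 1 + i - c = d + k + 1 + a + (i + 1) - c := fun i => by omega
  have e3 : ∀ i, d + k + 1 - (d + 1) - i = d + k + 1 - d - (i + 1) := fun i => by omega
  have e4 : ∀ i, d + k + 1 - 1 - d - i = d + k + 1 - d - (i + 1) := fun i => by omega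
  have e5 : ∀ i, d + k + 1 + a + 1 - 1 + i - c = d + k + 1 + a + i - c := fun i => by omega
  simp only [e1, e2, e3, e4, e5]
  push_cast
  rw [t, show (a : K) + 1 + 1 = a + 2 by ring]

/-- On the diagonal r = s the shape (r-1, s) is not available; the boundary term that replaces it is
antisymmetric in c and d, so it disappears on symmetrizing. -/
theorem rowSum_three_term_self [CharZero K] (hθ : ∀ n : ℕ, (n : K) + θ ≠ 0) (γ : ℕ → K)
    (r c d : ℕ) (hd : d < r) (hc : c < r) :
    rowSum θ γ r r (c + 1) d + rowSum θ γ r r c (d + 1) =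
      2 / (1 + θ) * rowSum θ γ r (r - 1) c d +
        (γ (r - 1 - c) * γ (r - d) - γ (r - c) * γ (r - 1 - d)) := by
  obtain ⟨k, rfl⟩ : ∃ k, r = d + k + 1 := ⟨r - d - 1, by omega⟩
  have t := sum_wellPoised_three_term_zero hθ
    (fun i => γ (d + k + i - c) * γ (d + k + 1 - d - i)) k
  unfold rowSum
  rw [Nat.sub_self, show d + k + 1 - d + 1 = k + 2 by omega,
    show d + k + 1 - (d + 1) + 1 = k + 1 by omega,
    show d + k + 1 - (d + k + 1 - 1) = 1 by omega,
    show d + k + 1 - 1 - d + 1 = k + 1 by omega]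
  have e1 : ∀ i, d + k + 1 + i - (c + 1) = d + k + i - c := fun i => by omega
  have e2 : ∀ i, d + k + 1 + i - c = d + k + (i + 1) - c := fun i => by omega
  have e3 : ∀ i, d + k + 1 - (d + 1) - i = d + k + 1 - d - (i + 1) := fun i => by omega
  have e4 : ∀ i, d + k + 1 - 1 - d - i = d + k + 1 - d - (i + 1) := fun i => by omega
  simp only [e1, e2, e3, e4]
  rw [t, show d + k + 1 - d - 1 = d + k + 1 - 1 - d by omega]
  rfl

/-- Induction on c + d. If c and d are both positive, lower all four parameters by one. Otherwise
the symmetrized three-term relation, whose right side vanishes by induction, links the pair (k+1, 0)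
to the pair (k, 1); the latter is the former again if k = 0 and reduces by the shift if k > 0. -/
theorem rowSum_add_rowSum_eq_zero [CharZero K] (hθ : ∀ n : ℕ, (n : K) + θ ≠ 0) {γ : ℕ → K}
    (hγ : IsRising θ γ) (r s c d : ℕ) (h : s ≤ r) (hcd : c + d < s) :
    rowSum θ γ r s c d + rowSum θ γ r s d c = 0 := by
  induction hn : c + d using Nat.strong_induction_on generalizing r s c d with
  | _ n ih =>
    subst hn
    have key : ∀ r s k, s ≤ r → k + 1 < s → k + 1 = c + d →
        rowSum θ γ r s (k + 1) 0 + rowSum θ γ r s 0 (k + 1) = 0 := by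
      intro r s k h hks hk
      have hadd : (rowSum θ γ r s (k + 1) 0 + rowSum θ γ r s 0 (k + 1)) +
          (rowSum θ γ r s k 1 + rowSum θ γ r s 1 k) = 0 := by
        have i1 := ih k (by omega) r (s - 1) k 0 (by omega) (by omega) rfl
        rcases h.lt_or_eq with h | rfl
        · have i2 := ih k (by omega) (r - 1) s k 0 (by omega) (by omega) rfl
          have t1 := rowSum_three_term hθ γ r s k 0 h (by omega) (by omega)
          have t2 := rowSum_three_term hθ γ r s 0 k h (by omega) (by omega)
          simp only [zero_add] at t1 t2
          linear_combination t1 + t2 + ((r - s : ℕ) + 1) * ((r - s : ℕ) + 2 * θ) /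
            (((r - s : ℕ) + θ) * ((r - s : ℕ) + 1 + θ)) * i1 + i2
        · have t1 := rowSum_three_term_self hθ γ s k 0 (by omega) (by omega)
          have t2 := rowSum_three_term_self hθ γ s 0 k (by omega) (by omega)
          simp only [zero_add] at t1 t2
          linear_combination t1 + t2 + 2 / (1 + θ) * i1
      rcases k with _ | k
      · simp only [zero_add] at hadd ⊢
        rw [add_comm (rowSum θ γ r s 0 1), ← two_mul] at hadd
        exact (mul_eq_zero.1 hadd).resolve_left two_ne_zero
      · obtain ⟨s, rfl⟩ := Nat.exists_eq_add_of_le' (show 1 ≤ s by omega)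
        obtain ⟨r, rfl⟩ := Nat.exists_eq_add_of_le' (show 1 ≤ r by omega)
        rw [rowSum_succ_succ θ γ r s k 0, rowSum_succ_succ θ γ r s 0 k,
          ih k (by omega) r s k 0 (by omega) (by omega) rfl, add_zero] at hadd
        exact hadd
    rcases c with _ | c <;> rcases d with _ | d
    -- At c = d = 0 both summands are the telescoping sum.
    · have := sum_wellPoised_mul_eq_zero hθ hγ (r - s) s (by omega)
      rw [Nat.sub_add_cancel h] at this
      simp only [rowSum, Nat.sub_zero, this, add_zero]
    · rw [add_comm]
      exact key r s d h (by omega) (by omega)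
    · exact key r s c h (by omega) (by omega)
    · obtain ⟨s, rfl⟩ := Nat.exists_eq_add_of_le' (show 1 ≤ s by omega)
      obtain ⟨r, rfl⟩ := Nat.exists_eq_add_of_le' (show 1 ≤ r by omega)
      rw [rowSum_succ_succ, rowSum_succ_succ]
      exact ih _ (by omega) r s c d (by omega) (by omega) rfl

/-! ### Evaluation of the binomial sums -/

/-- The binomial sum `∑ i, a_i choose (r + s) (s - i)`. -/
noncomputable def binomSum (θ : K) (r s : ℕ) : K :=
  ∑ i ∈ range (s + 1), wellPoised θ (r - s) i * ((r + s).choose (s - i) : K)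

theorem sum_choose_pascal (w : ℕ → K) (n s : ℕ) :
    ∑ i ∈ range (s + 2), w i * ((n + 1).choose (s + 1 - i) : K) =
      ∑ i ∈ range (s + 2), w i * (n.choose (s + 1 - i) : K) +
        ∑ i ∈ range (s + 1), w i * (n.choose (s + 1 - (i + 1)) : K) := by
  rw [sum_range_succ, sum_range_succ _ (s + 1), add_right_comm, ← sum_add_distrib]
  refine congrArg₂ (· + ·) (sum_congr rfl fun i hi => ?_) (by simp)
  rw [show s + 1 - i = s + 1 - (i + 1) + 1 by have := mem_range.1 hi; omega, Nat.choose_succ_succ]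
  push_cast
  ring

theorem binomSum_three_term [CharZero K] (hθ : ∀ n : ℕ, (n : K) + θ ≠ 0) (a s : ℕ) :
    binomSum θ (s + 1 + (a + 1)) (s + 1) =
      (a + 2) * (a + 1 + 2 * θ) / ((a + 1 + θ) * (a + 2 + θ)) * binomSum θ (s + (a + 2)) s +
        binomSum θ (s + 1 + a) (s + 1) := by
  unfold binomSum
  rw [show s + 1 + (a + 1) - (s + 1) = a + 1 by omega, show s + 1 + a - (s + 1) = a by omega,
    show s + (a + 2) - s = a + 2 by omega,
    show s + 1 + (a + 1) + (s + 1) = s + (a + 2) + s + 1 by omega,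
    show s + 1 + a + (s + 1) = s + (a + 2) + s by omega, sum_choose_pascal,
    sum_wellPoised_three_term hθ (fun i => ((s + (a + 2) + s).choose (s + 1 - i) : K))]
  simp only [Nat.add_sub_add_right]

theorem binomSum_self [CharZero K] (hθ : ∀ n : ℕ, (n : K) + θ ≠ 0) (s : ℕ) :
    binomSum θ (s + 1) (s + 1) = 2 / (1 + θ) * binomSum θ (s + 1) s := by
  unfold binomSum
  rw [Nat.sub_self, show s + 1 - s = 1 by omega,
    show s + 1 + (s + 1) = s + 1 + s + 1 by omega, sum_choose_pascal,
    sum_wellPoised_three_term_zero hθ (fun i => ((s + 1 + s).choose (s + 1 - i) : K))]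
  -- The boundary term of the diagonal relation vanishes because the two central binomial
  -- coefficients agree.
  have : (s + 1 + s).choose (s + 1) = (s + 1 + s).choose s := Nat.choose_symm_add
  simp [this]

/-- Both sides satisfy the same recurrence, which steps from (a, s+1) to (a+1, s+1) with the help of
(a+2, s), and starts each row s+1 from (1, s). Hence the outer induction on s for all a, and the
inner one on a. -/
theorem binomSum_eq [CharZero K] (hθ : ∀ n : ℕ, (n : K) + θ ≠ 0) (a s : ℕ) :
    binomSum θ (s + a) s * (a.factorial * s.factorial * ∏ t ∈ range s, (a + 1 + t + θ)) =
      (2 * s + a).factorial := by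
  have hD : ∀ a s : ℕ, ∏ t ∈ range s, ((a : K) + 1 + t + θ) ≠ 0 := fun a s =>
    prod_ne_zero_iff.2 fun t _ => by have := hθ (a + 1 + t); push_cast at this; exact this
  have hf : ∀ n : ℕ, (n.factorial : K) ≠ 0 := fun n => by exact_mod_cast n.factorial_ne_zero
  have hD1 : ∀ a s : ℕ, ∏ t ∈ range (s + 1), ((a : K) + 1 + t + θ) =
      (a + 1 + θ) * ∏ t ∈ range s, (((a + 1 : ℕ) : K) + 1 + t + θ) := fun a s => by
    rw [prod_range_succ', mul_comm]
    congr 1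
    · simp
    · refine prod_congr rfl fun t _ => by push_cast; ring
  induction s generalizing a with
  | zero => simp [binomSum, wellPoised]
  | succ s ihs =>
    induction a with
    | zero =>
      have i1 := ihs 1
      have h1 := hθ 1
      rw [add_zero, binomSum_self hθ, hD1 0 s]
      rw [← eq_div_iff (mul_ne_zero (mul_ne_zero (hf 1) (hf s)) (hD 1 s))] at i1
      have := hD 1 s
      have := hf s
      have h2 : ((s : K) + 1) ≠ 0 := by exact_mod_cast Nat.succ_ne_zero s
      rw [i1, show 2 * (s + 1) + 0 = 2 * s + 1 + 1 by ring, Nat.factorial_succ (2 * s + 1),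
        Nat.factorial_succ s, Nat.factorial_one, Nat.factorial_zero]
      push_cast at *
      simp only [zero_add] at *
      field_simp
      ring
    | succ a iha =>
      have i1 := ihs (a + 2)
      have h1 := hθ (a + 1)
      have h2 := hθ (a + 2)
      have h3 := hθ (a + 2 + s)
      have d1 := hD (a + 2) s
      have d2 := hD (a + 1) s
      have d3 := hf a
      have d4 := hf s
      have e0 := hD1 (a + 1) s
      have s1 : (a : K) + 1 ≠ 0 := by exact_mod_cast Nat.succ_ne_zero a
      have s2 : (a : K) + 2 ≠ 0 := by exact_mod_cast Nat.succ_ne_zero (a + 1)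
      have s3 : (s : K) + 1 ≠ 0 := by exact_mod_cast Nat.succ_ne_zero s
      have f2 := Nat.factorial_succ (a + 1)
      rw [Nat.factorial_succ a] at f2
      have f3 := Nat.factorial_succ (2 * s + (a + 2))
      rw [show 2 * s + (a + 2) + 1 = 2 * (s + 1) + (a + 1) by ring] at f3
      rw [show 2 * (s + 1) + a = 2 * s + (a + 2) by ring, hD1 a s] at iha
      rw [e0, f3, binomSum_three_term hθ, Nat.factorial_succ a]
      rw [prod_range_succ] at e0
      rw [f2] at i1
      rw [Nat.factorial_succ s] at iha ⊢
      generalize binomSum θ (s + (a + 2)) s = B1 at *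
      generalize binomSum θ (s + 1 + a) (s + 1) = B2 at *
      generalize ∏ t ∈ range s, (((a + 1 + 1 : ℕ) : K) + 1 + t + θ) = D2 at *
      generalize ∏ t ∈ range s, (((a + 1 : ℕ) : K) + 1 + t + θ) = D1 at *
      push_cast at *
      rw [show (a : K) + 1 + 1 = a + 2 by ring] at *
      generalize ((2 * s + (a + 2)).factorial : K) = N at *
      generalize (a.factorial : K) = A at *
      generalize (s.factorial : K) = S at *
      have hB1 : B1 = N / (((a : K) + 2) * ((a + 1) * A) * S * D2) := by
        rw [eq_div_iff (by positivity)]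
        linear_combination i1
      have hB2 : B2 = N / (A * ((s + 1) * S) * ((a + 1 + θ) * D1)) := by
        rw [eq_div_iff (by positivity)]
        linear_combination iha
      have hD1 : D1 = (a + 2 + θ) * D2 / (a + 2 + s + θ) := by
        rw [eq_div_iff h3]; exact e0
      rw [hB1, hB2, hD1]
      field_simp
      ring

end WellPoised

/-! ### Power sums and derivations -/

/-- Homogeneity, where the power sum `p_k` has degree `k`. -/
abbrev Homog (n : ℕ) (f : SymFun) : Prop :=
  MvPolynomial.IsWeightedHomogeneous (fun k : ℕ+ => (k : ℕ)) f n

theorem scalar_add_left (f g h : SymFun) : scalar (f + g) h = scalar f h + scalar g h := by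
  rw [scalar_comm, scalar_add_right, scalar_comm h f, scalar_comm h g]

theorem scalar_smul_left (f g : SymFun) (c : F) : scalar (c • f) g = c * scalar f g := by
  rw [scalar_comm, scalar_smul_right, scalar_comm]

/-- Pairing with a symmetric function, as a linear functional. -/
noncomputable def pairing (f : SymFun) : SymFun →ₗ[F] F where
  toFun := scalar f
  map_add' := scalar_add_right f
  map_smul' c g := scalar_smul_right f g c

theorem scalar_sum_right {ι : Type*} (f : SymFun) (s : Finset ι) (g : ι → SymFun) :
    scalar f (∑ i ∈ s, g i) = ∑ i ∈ s, scalar f (g i) :=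
  map_sum (pairing f) g s

theorem scalar_sum_left {ι : Type*} (f : SymFun) (s : Finset ι) (g : ι → SymFun) :
    scalar (∑ i ∈ s, g i) f = ∑ i ∈ s, scalar (g i) f := by
  simp only [scalar_comm _ f, scalar_sum_right]

theorem scalar_zero_left (f : SymFun) : scalar 0 f = 0 := by
  rw [scalar_comm, scalar_zero_right]

theorem scalar_monomial_left (d : ℕ+ →₀ ℕ) (c : F) (g : SymFun) :
    scalar (MvPolynomial.monomial d c) g = c * g.coeff d * weight d := by
  classical
  rw [scalar_eq_sum g (MvPolynomial.support_monomial_subset), sum_singleton,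
    MvPolynomial.coeff_monomial, if_pos rfl]

theorem α_ne_zero : α ≠ 0 := RatFunc.X_ne_zero

theorem weight_ne_zero (d : ℕ+ →₀ ℕ) : weight d ≠ 0 := by
  refine mul_ne_zero (pow_ne_zero _ α_ne_zero) (prod_ne_zero_iff.2 fun k _ => ?_)
  refine mul_ne_zero (pow_ne_zero _ ?_) ?_
  · exact_mod_cast k.ne_zero
  · exact_mod_cast Nat.factorial_ne_zero _

theorem weight_zero : weight 0 = 1 := by simp [weight]

theorem weight_add_single (d : ℕ+ →₀ ℕ) (k : ℕ+) :
    weight (d + Finsupp.single k 1) = α * ((k : ℕ) : F) * (d k + 1) * weight d := by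
  classical
  unfold weight
  have h : ∀ e : ℕ+ →₀ ℕ, e.support ⊆ insert k d.support →
      (e.prod fun k n => ((k : ℕ) : F) ^ n * (n.factorial : F)) =
        ∏ j ∈ insert k d.support, ((j : ℕ) : F) ^ e j * ((e j).factorial : F) := fun e he =>
    Finsupp.prod_of_support_subset _ he _ (fun _ _ => by simp)
  have h1 : (d + Finsupp.single k 1).support ⊆ insert k d.support := by
    intro j hj
    by_cases hjk : j = k
    · simp [hjk]
    · simp [Ne.symm hjk] at hj
      simp [hj]
  rw [h d (subset_insert _ _), h _ h1, map_add, Finsupp.degree_single,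
    ← mul_prod_erase _ _ (mem_insert_self k _), ← mul_prod_erase _ _ (mem_insert_self k d.support)]
  have h2 : ∏ j ∈ (insert k d.support).erase k, ((j : ℕ) : F) ^ (d + Finsupp.single k 1 : ℕ+ →₀ ℕ) j *
      (((d + Finsupp.single k 1 : ℕ+ →₀ ℕ) j).factorial : F) =
      ∏ j ∈ (insert k d.support).erase k, ((j : ℕ) : F) ^ d j * ((d j).factorial : F) := by
    refine prod_congr rfl fun j hj => ?_
    have : j ≠ k := ne_of_mem_erase hj
    simp [this]
  rw [h2]
  simp only [Finsupp.add_apply, Finsupp.single_eq_same, Nat.factorial_succ, pow_succ]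
  push_cast
  ring

/-- Multiplication by a power sum is adjoint to a multiple of a partial derivative. -/
theorem scalar_X_mul (k : ℕ+) (f g : SymFun) :
    scalar f (MvPolynomial.X k * g) =
      α * ((k : ℕ) : F) * scalar (MvPolynomial.pderiv k f) g := by
  classical
  induction f using MvPolynomial.induction_on' with
  | monomial d c =>
    rw [MvPolynomial.pderiv_monomial, scalar_monomial_left, scalar_monomial_left,
      MvPolynomial.coeff_X_mul']
    split_ifs with hk
    · have hk' : d k ≠ 0 := Finsupp.mem_support_iff.1 hk
      obtain ⟨e, rfl⟩ : ∃ e, d = e + Finsupp.single k 1 := ⟨d - Finsupp.single k 1,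
        (tsub_add_cancel_of_le (Finsupp.single_le_iff.2 (Nat.one_le_iff_ne_zero.2 hk'))).symm⟩
      rw [add_tsub_cancel_right, weight_add_single]
      simp only [Finsupp.add_apply, Finsupp.single_eq_same]
      push_cast
      ring
    · rw [Finsupp.notMem_support_iff.1 hk]
      simp
  | add p q hp hq => rw [scalar_add_left, hp, hq, map_add, scalar_add_left, mul_add]

theorem sum_toMultiset_eq_weight (d : ℕ+ →₀ ℕ) :
    ((Finsupp.toMultiset d).map PNat.val).sum = Finsupp.weight (fun k : ℕ+ => (k : ℕ)) d := by
  rw [Finsupp.weight_apply, Finsupp.toMultiset_map, Finsupp.sum_toMultiset,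
    Finsupp.sum_mapDomain_index (by simp) (fun _ _ _ => add_mul _ _ _)]

theorem toMultiset_pExponent {n : ℕ} (κ : n.Partition) :
    (Finsupp.toMultiset (pExponent κ)).map PNat.val = κ.parts := by
  rw [pExponent, Multiset.toFinsupp_toMultiset, Multiset.map_map]
  conv_rhs => rw [← Multiset.map_id κ.parts]
  refine Multiset.map_congr rfl fun i hi => ?_
  have := κ.parts_pos hi
  simp
  omega

theorem weight_pExponent {n : ℕ} (κ : n.Partition) :
    Finsupp.weight (fun k : ℕ+ => (k : ℕ)) (pExponent κ) = n := by
  rw [← sum_toMultiset_eq_weight, toMultiset_pExponent, κ.parts_sum]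

theorem pExponent_injective {n : ℕ} : Function.Injective (pExponent (n := n)) := fun κ κ' h => by
  ext1
  rw [← toMultiset_pExponent, h, toMultiset_pExponent]

theorem exists_pExponent_eq (d : ℕ+ →₀ ℕ) {n : ℕ}
    (hd : Finsupp.weight (fun k : ℕ+ => (k : ℕ)) d = n) : ∃ κ : n.Partition, pExponent κ = d := by
  refine ⟨⟨(Finsupp.toMultiset d).map PNat.val, fun hi => ?_, ?_⟩, ?_⟩
  · obtain ⟨k, -, rfl⟩ := Multiset.mem_map.1 hi
    exact k.pos
  · rw [sum_toMultiset_eq_weight, hd]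
  · rw [pExponent, Multiset.map_map]
    have : (Finsupp.toMultiset d).map (Nat.toPNat' ∘ PNat.val) = Finsupp.toMultiset d := by
      conv_rhs => rw [← Multiset.map_id (Finsupp.toMultiset d)]
      exact Multiset.map_congr rfl fun k _ => by simp
    rw [this, Finsupp.toMultiset_toFinsupp]

theorem coeff_qRow (n : ℕ) (d : ℕ+ →₀ ℕ) :
    (qRow n).coeff d =
      if Finsupp.weight (fun k : ℕ+ => (k : ℕ)) d = n then (weight d)⁻¹ else 0 := by
  classical
  rw [qRow, MvPolynomial.coeff_sum]
  simp only [MvPolynomial.coeff_monomial]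
  split_ifs with h
  · obtain ⟨κ, rfl⟩ := exists_pExponent_eq d h
    rw [sum_eq_single κ (fun κ' _ hne => if_neg fun h => hne (pExponent_injective h)) (by simp),
      if_pos rfl]
  · exact sum_eq_zero fun κ _ => if_neg fun h' => h (by rw [← h', weight_pExponent])

theorem homog_qRow (n : ℕ) : Homog n (qRow n) := by
  intro d hd
  rw [coeff_qRow] at hd
  by_contra h
  exact hd (if_neg h)

theorem qRow_zero : qRow 0 = 1 := by
  classical
  ext d
  rw [coeff_qRow, MvPolynomial.coeff_one]
  by_cases hd : d = 0
  · simp [hd, weight_zero]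
  · rw [if_neg (Ne.symm hd), if_neg]
    intro h
    rw [← sum_toMultiset_eq_weight, Multiset.sum_eq_zero_iff] at h
    obtain ⟨k, hk⟩ := Finsupp.support_nonempty_iff.2 hd
    have := h k (Multiset.mem_map_of_mem _ (Finsupp.mem_toMultiset d k |>.2 hk))
    exact k.ne_zero this

/-- The generating series Σ q_n t^n is exp(Σ p_k t^k / (kα)), an eigenvector of every derivative
∂/∂p_k. -/
theorem pderiv_qRow (k : ℕ+) (n : ℕ) :
    (α * ((k : ℕ) : F)) • MvPolynomial.pderiv k (qRow n) =
      if (k : ℕ) ≤ n then qRow (n - k) else 0 := by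
  classical
  ext d
  have hk : ((k : ℕ) : F) ≠ 0 := by exact_mod_cast k.ne_zero
  have hd : ((d k : F) + 1) ≠ 0 := by exact_mod_cast Nat.succ_ne_zero (d k)
  rw [MvPolynomial.coeff_smul, MvPolynomial.coeff_pderiv, coeff_qRow, map_add,
    Finsupp.weight_single, one_smul, weight_add_single, smul_eq_mul]
  have hα := α_ne_zero
  have hw := weight_ne_zero d
  by_cases h : Finsupp.weight (fun k : ℕ+ => (k : ℕ)) d + k = n
  · rw [if_pos h, if_pos (by omega), coeff_qRow, if_pos (by omega)]
    field_simp
  · rw [if_neg h]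
    split_ifs with h'
    · rw [coeff_qRow, if_neg (by omega)]
      simp
    · simp

theorem scalar_eq_zero_of_homog {f g : SymFun} {n n' : ℕ} (hf : Homog n f) (hg : Homog n' g)
    (h : n ≠ n') : scalar f g = 0 := by
  refine sum_eq_zero fun d _ => ?_
  by_cases h1 : f.coeff d = 0
  · simp [h1]
  · by_cases h2 : g.coeff d = 0
    · simp [h2]
    · exact absurd ((hf h1).symm.trans (hg h2)) h

/-! ### Duality of the q_μ and the monomial functions -/

/-- The product of the `q_n` over the parts of a multiset. -/
noncomputable def qMul (s : Multiset ℕ) : SymFun := (s.map qRow).prod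

theorem qMul_cons (n : ℕ) (s : Multiset ℕ) : qMul (n ::ₘ s) = qRow n * qMul s := by
  simp [qMul]

theorem qMul_zero : qMul 0 = 1 := by simp [qMul]

theorem qMul_pair (a b : ℕ) : qMul {a, b} = qRow a * qRow b := by simp [qMul]

theorem homog_qMul (s : Multiset ℕ) : Homog s.sum (qMul s) := by
  induction s using Multiset.induction_on with
  | empty => simpa [qMul_zero] using MvPolynomial.isWeightedHomogeneous_one _ _
  | cons n s ih =>
    rw [qMul_cons, Multiset.sum_cons]
    exact (homog_qRow n).mul ih

/-- The exponents of a monomial, as a multiset. -/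
def exps (e : ℕ →₀ ℕ) : Multiset ℕ := e.support.val.map e

theorem qMul_exps (e : ℕ →₀ ℕ) {s : Finset ℕ} (hs : e.support ⊆ s) :
    qMul (exps e) = ∏ i ∈ s, qRow (e i) := by
  rw [qMul, exps, Multiset.map_map]
  exact prod_subset hs fun i _ hi => by
    simp [Finsupp.notMem_support_iff.1 hi, qRow_zero]

theorem pderiv_prod (k : ℕ+) (s : Finset ℕ) (f : ℕ → SymFun) :
    MvPolynomial.pderiv k (∏ i ∈ s, f i) =
      ∑ i ∈ s, (∏ j ∈ s.erase i, f j) * MvPolynomial.pderiv k (f i) := by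
  induction s using Finset.induction_on with
  | empty => simp
  | insert a s ha ih =>
    rw [prod_insert ha, MvPolynomial.pderiv_mul, ih, sum_insert ha, erase_insert ha, mul_sum,
      mul_comm (MvPolynomial.pderiv k (f a))]
    congr 1
    refine sum_congr rfl fun i hi => ?_
    have : a ≠ i := fun h => ha (h ▸ hi)
    rw [erase_insert_of_ne this, prod_insert (fun h => ha (mem_of_mem_erase h)), mul_assoc]

/-- By Leibniz, the adjoint of multiplication by p_k acts on these products by the very recursion
that `coeff_powerSumSeries_mul` gives for coefficients of p_k G. This match is the reason for the
duality. -/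
theorem pderiv_qMul_exps (k : ℕ+) (e : ℕ →₀ ℕ) :
    (α * ((k : ℕ) : F)) • MvPolynomial.pderiv k (qMul (exps e)) =
      ∑ i ∈ e.support, if (k : ℕ) ≤ e i then qMul (exps (e - Finsupp.single i (k : ℕ))) else 0 := by
  classical
  rw [qMul_exps e subset_rfl, pderiv_prod, smul_sum]
  refine sum_congr rfl fun i hi => ?_
  rw [mul_comm (∏ j ∈ _, _), ← smul_mul_assoc, pderiv_qRow, ite_mul, zero_mul]
  congr 1
  have hsub : (e - Finsupp.single i (k : ℕ)).support ⊆ e.support :=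
    Finsupp.support_mono tsub_le_self
  rw [qMul_exps _ hsub, ← mul_prod_erase _ _ hi]
  congr 1
  · simp
  · refine prod_congr rfl fun j hj => ?_
    have : j ≠ i := ne_of_mem_erase hj
    simp [this]

theorem scalar_one_right (f : SymFun) : scalar f 1 = f.coeff 0 := by
  rw [scalar_comm, MvPolynomial.one_def, scalar_monomial_left, weight_zero, one_mul, mul_one]

theorem coeff_zero_qMul (s : Multiset ℕ) (hs : s.sum ≠ 0) : (qMul s).coeff 0 = 0 := by
  by_contra h
  have := homog_qMul s h
  rw [map_zero] at this
  exact hs this.symm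

theorem exps_sum_eq_zero_iff {e : ℕ →₀ ℕ} : (exps e).sum = 0 ↔ e = 0 := by
  rw [exps, Multiset.sum_eq_zero_iff]
  constructor
  · intro h
    by_contra hne
    obtain ⟨i, hi⟩ := Finsupp.support_nonempty_iff.2 hne
    exact Finsupp.mem_support_iff.1 hi (h _ (Multiset.mem_map_of_mem _ hi))
  · rintro rfl
    simp

/-- The functions `q_μ` are dual to the monomial functions: they read off the coefficients. -/
theorem coeff_toSeries (g : SymFun) (e : ℕ →₀ ℕ) :
    MvPowerSeries.coeff e (toSeries g) = scalar (qMul (exps e)) g := by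
  classical
  induction g using MvPolynomial.induction_on generalizing e with
  | C c =>
    have hC : MvPolynomial.C c = c • (1 : SymFun) := by
      rw [MvPolynomial.smul_eq_C_mul, mul_one]
    rw [hC, map_smul, map_one, scalar_smul_right, scalar_one_right, map_smul, smul_eq_mul,
      MvPowerSeries.coeff_one]
    congr 1
    split_ifs with he
    · subst he
      simp [exps, qMul_zero]
    · exact (coeff_zero_qMul _ (mt exps_sum_eq_zero_iff.1 he)).symm
  | add p q hp hq => rw [map_add, map_add, hp, hq, scalar_add_right]
  | mul_X p k hp =>
    rw [mul_comm, map_mul, scalar_X_mul, ← scalar_smul_left, pderiv_qMul_exps, scalar_sum_left]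
    have : toSeries (MvPolynomial.X k) = powerSumSeries k := by simp [toSeries]
    rw [this, coeff_powerSumSeries_mul]
    refine sum_congr rfl fun i _ => ?_
    split_ifs
    · exact hp _
    · exact (scalar_zero_left _).symm

/-! ### Restriction to one and two variables -/

/-- Restriction to two variables. -/
noncomputable def restrict₂ : SymFun →ₐ[F] Polynomial (Polynomial F) :=
  MvPolynomial.aeval fun k : ℕ+ => Polynomial.X ^ (k : ℕ) + Polynomial.C (Polynomial.X ^ (k : ℕ))

/-- The two-variable form of the duality. Since restriction is a ring homomorphism, pairing with q_a
q_b obeys a convolution rule on products. -/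
theorem coeff_restrict₂ (g : SymFun) (a b : ℕ) :
    ((restrict₂ g).coeff a).coeff b = scalar (qRow a * qRow b) g := by
  induction g using MvPolynomial.induction_on generalizing a b with
  | C c =>
    have hC : MvPolynomial.C c = c • (1 : SymFun) := by
      rw [MvPolynomial.smul_eq_C_mul, mul_one]
    rw [hC, map_smul, map_one, scalar_smul_right, scalar_one_right, Polynomial.coeff_smul,
      Polynomial.coeff_smul, smul_eq_mul, Polynomial.coeff_one]
    congr 1
    rcases Nat.eq_zero_or_pos a with rfl | ha
    · rcases Nat.eq_zero_or_pos b with rfl | hb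
      · simp [qRow_zero]
      · rw [if_pos rfl, Polynomial.coeff_one, if_neg hb.ne', ← qMul_pair, coeff_zero_qMul]
        simpa using hb.ne'
    · rw [if_neg ha.ne', Polynomial.coeff_zero, ← qMul_pair, coeff_zero_qMul]
      simp [ha.ne']
  | add p q hp hq =>
    rw [map_add, Polynomial.coeff_add, Polynomial.coeff_add, hp, hq, scalar_add_right]
  | mul_X p k hp =>
    rw [mul_comm, map_mul, scalar_X_mul, ← scalar_smul_left, MvPolynomial.pderiv_mul, smul_add,
      ← smul_mul_assoc, ← mul_smul_comm, pderiv_qRow, pderiv_qRow, scalar_add_left]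
    have : restrict₂ (MvPolynomial.X k) =
      Polynomial.X ^ (k : ℕ) + Polynomial.C (Polynomial.X ^ (k : ℕ)) := by simp [restrict₂]
    rw [this, add_mul, Polynomial.coeff_add, Polynomial.coeff_add, Polynomial.coeff_X_pow_mul',
      Polynomial.coeff_C_mul, Polynomial.coeff_X_pow_mul']
    congr 1
    · split_ifs
      · exact hp _ _
      · rw [zero_mul, scalar_zero_left, Polynomial.coeff_zero]
    · split_ifs
      · exact hp _ _
      · rw [mul_zero, scalar_zero_left]

theorem scalar_qRow_mul_qRow_mul (f g : SymFun) (a b : ℕ) :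
    scalar (qRow a * qRow b) (f * g) =
      ∑ x ∈ antidiagonal a, ∑ y ∈ antidiagonal b,
        scalar (qRow x.1 * qRow y.1) f * scalar (qRow x.2 * qRow y.2) g := by
  rw [← coeff_restrict₂, map_mul, Polynomial.coeff_mul, Polynomial.finsetSum_coeff]
  refine sum_congr rfl fun x _ => ?_
  rw [Polynomial.coeff_mul]
  refine sum_congr rfl fun y _ => ?_
  rw [coeff_restrict₂, coeff_restrict₂]

theorem scalar_qRow_mul (f g : SymFun) (a : ℕ) :
    scalar (qRow a) (f * g) =
      ∑ x ∈ antidiagonal a, scalar (qRow x.1) f * scalar (qRow x.2) g := by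
  have := scalar_qRow_mul_qRow_mul f g a 0
  simpa [qRow_zero] using this

/-! ### Nonvanishing of the denominators -/

theorem nat_add_α_ne_zero (n : ℕ) : (n : F) + α ≠ 0 := by
  have h : (n : F) + α = algebraMap (Polynomial ℚ) F ((n : Polynomial ℚ) + Polynomial.X) := by
    rw [map_add, map_natCast, RatFunc.algebraMap_X]
  rw [h]
  refine (map_ne_zero_iff _ (IsFractionRing.injective (Polynomial ℚ) F)).2 fun h0 => ?_
  have := congrArg (fun p => Polynomial.coeff p 1) h0
  simp [Polynomial.coeff_natCast_ite] at this

theorem one_add_nat_mul_α_ne_zero (n : ℕ) : 1 + (n : F) * α ≠ 0 := by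
  have h : 1 + (n : F) * α =
      algebraMap (Polynomial ℚ) F (1 + (n : Polynomial ℚ) * Polynomial.X) := by
    rw [map_add, map_mul, map_natCast, RatFunc.algebraMap_X, map_one]
  rw [h]
  refine (map_ne_zero_iff _ (IsFractionRing.injective (Polynomial ℚ) F)).2 fun h0 => ?_
  have := congrArg (Polynomial.eval 0) h0
  simp at this

theorem nat_add_inv_α_ne_zero (n : ℕ) : (n : F) + α⁻¹ ≠ 0 := by
  have h : (n : F) + α⁻¹ = (1 + n * α) * α⁻¹ := by
    have := α_ne_zero
    field_simp
    ring
  rw [h]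
  exact mul_ne_zero (one_add_nat_mul_α_ne_zero n) (inv_ne_zero α_ne_zero)

/-! ### Rescaling the power sums -/

/-- The endomorphism `p_k ↦ c_k p_k`. -/
noncomputable def rescale (c : ℕ+ → F) : SymFun →ₐ[F] SymFun :=
  MvPolynomial.aeval fun k => c k • MvPolynomial.X k

theorem rescale_X (c : ℕ+ → F) (k : ℕ+) :
    rescale c (MvPolynomial.X k) = c k • MvPolynomial.X k := by simp [rescale]

theorem rescale_monomial (c : ℕ+ → F) (d : ℕ+ →₀ ℕ) (a : F) :
    rescale c (MvPolynomial.monomial d a) =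
      MvPolynomial.monomial d ((d.prod fun k n => c k ^ n) * a) := by
  rw [rescale, MvPolynomial.aeval_monomial, MvPolynomial.monomial_eq, MvPolynomial.algebraMap_eq,
    map_mul, mul_comm (MvPolynomial.C _) (MvPolynomial.C a), mul_assoc]
  congr 1
  simp only [Finsupp.prod, map_prod, ← prod_mul_distrib, MvPolynomial.smul_eq_C_mul, mul_pow,
    map_pow]

theorem coeff_rescale (c : ℕ+ → F) (f : SymFun) (d : ℕ+ →₀ ℕ) :
    (rescale c f).coeff d = (d.prod fun k n => c k ^ n) * f.coeff d := by
  classical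
  induction f using MvPolynomial.induction_on' with
  | monomial e a =>
    rw [rescale_monomial, MvPolynomial.coeff_monomial, MvPolynomial.coeff_monomial]
    split_ifs with h
    · rw [h]
    · rw [mul_zero]
  | add p q hp hq => rw [map_add, MvPolynomial.coeff_add, hp, hq, MvPolynomial.coeff_add, mul_add]

/-- Rescaling is diagonal in the orthogonal basis p_κ. -/
theorem scalar_rescale (c : ℕ+ → F) (f g : SymFun) :
    scalar (rescale c f) g = scalar f (rescale c g) := by
  classical
  rw [scalar_eq_sum g (subset_union_left (s₂ := f.support)),
    scalar_eq_sum _ (subset_union_right (s₁ := (rescale c f).support))]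
  refine sum_congr rfl fun d _ => ?_
  rw [coeff_rescale, coeff_rescale]
  ring

theorem Homog.rescale {n : ℕ} {f : SymFun} (hf : Homog n f) (c : ℕ+ → F) :
    Homog n (rescale c f) := by
  intro d hd
  rw [coeff_rescale] at hd
  exact hf (right_ne_zero_of_mul hd)

theorem rescale_rescale (c c' : ℕ+ → F) (f : SymFun) :
    rescale c (rescale c' f) = rescale (fun k => c k * c' k) f := by
  ext d
  rw [coeff_rescale, coeff_rescale, coeff_rescale, ← mul_assoc]
  congr 1
  simp only [Finsupp.prod, ← prod_mul_distrib, mul_pow]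

theorem rescale_one (f : SymFun) : rescale (fun _ => 1) f = f := by
  ext d
  simp [coeff_rescale, Finsupp.prod]

/-- Newton's identity for the functions `q_n`. -/
theorem newton_qRow (n : ℕ) :
    (n : F) • qRow n =
      α⁻¹ • ∑ j ∈ range n, MvPolynomial.X j.succPNat * qRow (n - 1 - j) := by
  classical
  ext d
  rw [MvPolynomial.coeff_smul, MvPolynomial.coeff_smul, MvPolynomial.coeff_sum, coeff_qRow]
  -- The term of p_k contributes k d_k times the coefficient of q_n at d, and Σ k d_k is the weight
  -- of d, namely n.
  have hterm : ∀ k : ℕ+, k ∈ d.support → ∀ i : ℕ,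
      α⁻¹ * (qRow i).coeff (d - Finsupp.single k 1) =
        if Finsupp.weight (fun k : ℕ+ => (k : ℕ)) d = i + k then
          ((d k * k : ℕ) : F) * (weight d)⁻¹ else 0 := by
    intro k hk i
    have hk' : d k ≠ 0 := Finsupp.mem_support_iff.1 hk
    obtain ⟨e, rfl⟩ : ∃ e, d = e + Finsupp.single k 1 := ⟨d - Finsupp.single k 1,
      (tsub_add_cancel_of_le (Finsupp.single_le_iff.2 (Nat.one_le_iff_ne_zero.2 hk'))).symm⟩
    rw [add_tsub_cancel_right, coeff_qRow, weight_add_single, map_add, Finsupp.weight_single,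
      one_smul]
    by_cases h : Finsupp.weight (fun k : ℕ+ => (k : ℕ)) e = i
    · rw [if_pos h, if_pos (by rw [h])]
      have h1 : ((k : ℕ) : F) ≠ 0 := by exact_mod_cast k.ne_zero
      have h2 : ((e k : F) + 1) ≠ 0 := by exact_mod_cast Nat.succ_ne_zero (e k)
      have := α_ne_zero
      have := weight_ne_zero e
      simp only [Finsupp.add_apply, Finsupp.single_eq_same]
      push_cast
      field_simp
    · rw [if_neg h, if_neg (by omega), mul_zero]
  rw [smul_eq_mul, smul_eq_mul, mul_sum]
  have hsum : ∀ j ∈ range n, α⁻¹ * (MvPolynomial.X j.succPNat * qRow (n - 1 - j)).coeff d =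
      if Finsupp.weight (fun k : ℕ+ => (k : ℕ)) d = n then
        ((d j.succPNat * (j + 1) : ℕ) : F) * (weight d)⁻¹ else 0 := by
    intro j hj
    have hj := mem_range.1 hj
    rw [MvPolynomial.coeff_X_mul']
    split_ifs with h1 h2 h2
    · rw [hterm _ h1, if_pos (by rw [Nat.succPNat_coe]; omega), Nat.succPNat_coe]
    · rw [hterm _ h1, if_neg (by rw [Nat.succPNat_coe]; omega)]
    · rw [Finsupp.notMem_support_iff.1 h1]
      simp
    · rw [mul_zero]
  rw [sum_congr rfl hsum]
  split_ifs with h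
  · rw [← sum_mul, ← Nat.cast_sum]
    congr 2
    conv_lhs => rw [← h]
    rw [Finsupp.weight_apply, Finsupp.sum]
    refine sum_of_injOn PNat.natPred (fun a _ b _ h => PNat.natPred_injective h) ?_ ?_ ?_
    · intro k hk
      have hk' : d k ≠ 0 := Finsupp.mem_support_iff.1 hk
      have h1 : (k : ℕ) ≤ n := by
        rw [← h, Finsupp.weight_apply, Finsupp.sum]
        refine le_trans ?_ (single_le_sum (f := fun k : ℕ+ => d k • (k : ℕ))
          (fun _ _ => Nat.zero_le _) hk)
        exact Nat.le_mul_of_pos_left _ (Nat.pos_of_ne_zero hk')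
      have := PNat.natPred_add_one k
      simp only [coe_range, Set.mem_Iio]
      omega
    · intro j _ hj
      have : d j.succPNat = 0 := by
        by_contra h0
        exact hj ⟨j.succPNat, Finsupp.mem_support_iff.2 h0, Nat.natPred_succPNat j⟩
      simp [this]
    · intro k _
      rw [PNat.succPNat_natPred, PNat.natPred_add_one, smul_eq_mul]
  · simp

theorem scalar_qRow_X_mul (n : ℕ) (k : ℕ+) (f : SymFun) (h : (k : ℕ) ≤ n) :
    scalar (qRow n) (MvPolynomial.X k * f) = scalar (qRow (n - k)) f := by
  rw [scalar_X_mul, ← scalar_smul_left, pderiv_qRow, if_pos h]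

/-- The coefficient of `x₀ ^ n` in a rescaled `q_n`. -/
noncomputable def rowCoeff (c : ℕ+ → F) (n : ℕ) : F := scalar (qRow n) (rescale c (qRow n))

theorem rowCoeff_zero (c : ℕ+ → F) : rowCoeff c 0 = 1 := by
  rw [rowCoeff, qRow_zero, map_one, scalar_one_right, MvPolynomial.coeff_zero_one]

theorem newton_rowCoeff (c : ℕ+ → F) (n : ℕ) :
    (n : F) * rowCoeff c n =
      α⁻¹ * ∑ j ∈ range n, c j.succPNat * rowCoeff c (n - 1 - j) := by
  rw [rowCoeff, ← scalar_smul_right, ← map_smul, newton_qRow, map_smul, scalar_smul_right, map_sum,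
    scalar_sum_right]
  congr 1
  refine sum_congr rfl fun j hj => ?_
  have hj := mem_range.1 hj
  rw [map_mul, rescale_X, smul_mul_assoc, scalar_smul_right, scalar_qRow_X_mul _ _ _ (by simpa),
    rowCoeff, Nat.succPNat_coe, show n - j.succ = n - 1 - j by omega]

theorem scalar_qRow_rescale_qMul (c : ℕ+ → F) (n : ℕ) (s : Multiset ℕ) :
    scalar (qRow n) (rescale c (qMul s)) = if s.sum = n then (s.map (rowCoeff c)).prod else 0 := by
  induction s using Multiset.induction_on generalizing n with
  | empty =>
    rw [qMul_zero, map_one, scalar_one_right, coeff_qRow, map_zero, weight_zero]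
    by_cases h : 0 = n <;> simp [h]
  | cons a s ih =>
    rw [qMul_cons, map_mul, scalar_qRow_mul]
    have h1 : ∀ m, scalar (qRow m) (rescale c (qRow a)) = if m = a then rowCoeff c a else 0 := by
      intro m
      split_ifs with h
      · rw [h]; rfl
      · exact scalar_eq_zero_of_homog (homog_qRow m) ((homog_qRow a).rescale c) h
    simp only [h1, ih, Multiset.sum_cons, Multiset.map_cons, Multiset.prod_cons]
    split_ifs with h
    · rw [sum_eq_single (a, s.sum)]
      · simp
      · rintro ⟨x, y⟩ hx hne
        by_cases hxa : x = a
        · by_cases hy : s.sum = y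
          · exact absurd (by rw [hxa, hy]) hne
          · simp [hy]
        · simp [hxa]
      · intro h'
        exact absurd (HasAntidiagonal.mem_antidiagonal.2 h) h'
    · refine sum_eq_zero fun x hx => ?_
      have := HasAntidiagonal.mem_antidiagonal.1 hx
      by_cases hxa : x.1 = a
      · rw [if_neg (show ¬ s.sum = x.2 by omega), mul_zero]
      · rw [if_neg hxa, zero_mul]

/-- The rescaled generating series is a product over the variables, so its coefficients are products
of one-variable coefficients. -/
theorem scalar_qMul_rescale_qRow (c : ℕ+ → F) (n : ℕ) (s : Multiset ℕ) :
    scalar (qMul s) (rescale c (qRow n)) = if s.sum = n then (s.map (rowCoeff c)).prod else 0 := by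
  rw [← scalar_rescale, scalar_comm, scalar_qRow_rescale_qMul]

theorem scalar_qRow_mul_qRow_rescale (c : ℕ+ → F) (n a b : ℕ) :
    scalar (qRow a * qRow b) (rescale c (qRow n)) =
      if a + b = n then rowCoeff c a * rowCoeff c b else 0 := by
  rw [← qMul_pair, scalar_qMul_rescale_qRow]
  simp

/-- For a constant scaling t, Newton's identities for n + 1 and n differ by one term. In one
variable the series is (1-x)^{-t/α}. -/
theorem isRising_rowCoeff (t : F) : IsRising (α⁻¹ * t) (rowCoeff fun _ => t) := by
  refine ⟨rowCoeff_zero _, fun n => ?_⟩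
  have h1 := newton_rowCoeff (fun _ => t) (n + 1)
  have h2 := newton_rowCoeff (fun _ => t) n
  rw [sum_range_succ'] at h1
  have h3 : ∀ j, n - 1 - j = n - (j + 1) := fun j => by omega
  simp only [Nat.add_sub_cancel, Nat.sub_zero] at h1
  simp only [h3] at h2
  push_cast at h1
  linear_combination h1 - h2

/-- The scaling that turns `q_n` into the elementary symmetric function. -/
noncomputable def signScale (k : ℕ+) : F := (-1) ^ k.natPred * α

/-- The alternating signs make two consecutive Newton sums cancel when added. The recurrence is that
of the coefficients of 1 + x. -/
theorem rowCoeff_signScale_succ (n : ℕ) :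
    (n + 1 : F) * rowCoeff signScale (n + 1) = (1 - n) * rowCoeff signScale n := by
  have h1 := newton_rowCoeff signScale (n + 1)
  have h2 := newton_rowCoeff signScale n
  rw [sum_range_succ'] at h1
  have h3 : ∀ j, n - 1 - j = n - (j + 1) := fun j => by omega
  simp only [h3] at h2
  simp only [Nat.add_sub_cancel, Nat.sub_zero, signScale, Nat.natPred_succPNat, pow_succ,
    pow_zero, mul_neg, mul_one, one_mul, neg_mul, sum_neg_distrib] at h1 h2
  push_cast at h1
  have h4 : α⁻¹ * α = 1 := inv_mul_cancel₀ α_ne_zero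
  linear_combination h1 + h2 + rowCoeff signScale n * h4

theorem rowCoeff_signScale_one : rowCoeff signScale 1 = 1 := by
  have := rowCoeff_signScale_succ 0
  rw [rowCoeff_zero] at this
  simpa using this

theorem rowCoeff_signScale_of_two_le (n : ℕ) (hn : 2 ≤ n) : rowCoeff signScale n = 0 := by
  induction n, hn using Nat.le_induction with
  | base =>
    have := rowCoeff_signScale_succ 1
    norm_num at this
    exact this
  | succ n _ ih =>
    have := rowCoeff_signScale_succ n
    rw [ih, mul_zero] at this
    refine (mul_eq_zero.1 this).resolve_left ?_
    exact_mod_cast Nat.succ_ne_zero n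

/-! ### The vanishing theorem -/

theorem sum_antidiagonal_antidiagonal_ite (a b N k : ℕ) (h : a + b = N + k)
    (G : ℕ → ℕ → ℕ → ℕ → F) :
    ∑ x ∈ antidiagonal a, ∑ y ∈ antidiagonal b,
        (if x.1 + y.1 = N then G x.1 y.1 x.2 y.2 else 0) =
      ∑ z ∈ antidiagonal k,
        if z.1 ≤ a ∧ z.2 ≤ b then G (a - z.1) (b - z.2) z.1 z.2 else 0 := by
  rw [← sum_product', ← sum_filter, ← sum_filter]
  refine sum_nbij' (fun w => (w.1.2, w.2.2)) (fun z => ((a - z.1, z.1), (b - z.2, z.2))) ?_ ?_ ?_ ?_ ?_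
  · rintro ⟨⟨x, x'⟩, y, y'⟩ hw
    simp only [mem_filter, mem_product, HasAntidiagonal.mem_antidiagonal] at hw ⊢
    omega
  · rintro ⟨c, d⟩ hw
    simp only [mem_filter, mem_product, HasAntidiagonal.mem_antidiagonal] at hw ⊢
    omega
  · rintro ⟨⟨x, x'⟩, y, y'⟩ hw
    simp only [mem_filter, mem_product, HasAntidiagonal.mem_antidiagonal] at hw
    simp only [Prod.mk.injEq, and_true]
    omega
  · rintro ⟨c, d⟩ _
    rfl
  · rintro ⟨⟨x, x'⟩, y, y'⟩ hw
    simp only [mem_filter, mem_product, HasAntidiagonal.mem_antidiagonal] at hw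
    rw [show a - x' = x by omega, show b - y' = y by omega]

/-- The combination `∑ i, a_i q_{r + i} q_{s - i}` with well-poised coefficients. -/
noncomputable def twoRowSum (θ : F) (r s : ℕ) : SymFun :=
  ∑ i ∈ range (s + 1), wellPoised θ (r - s) i • (qRow (r + i) * qRow (s - i))

theorem scalar_twoRowSum (θ : F) (r s : ℕ) (f : SymFun) :
    scalar (twoRowSum θ r s) f =
      ∑ i ∈ range (s + 1), wellPoised θ (r - s) i * scalar (qRow (r + i) * qRow (s - i)) f := by
  rw [twoRowSum, scalar_sum_left]
  simp only [scalar_smul_left]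

/-- R stands for a function whose two-variable restriction is homogeneous of degree N with
coefficients γ_u γ_v: q_N itself for rows, a rescaled q_N for columns. The claim then reduces to the
antisymmetry of `rowSum`. -/
theorem scalar_twoRowSum_mul_eq_zero {θ : F} (hθ : ∀ n : ℕ, (n : F) + θ ≠ 0) {γ : ℕ → F}
    (hγ : IsRising θ γ) {R : SymFun} {N : ℕ}
    (hR : ∀ u v, scalar (qRow u * qRow v) R = if u + v = N then γ u * γ v else 0)
    {r s : ℕ} (hsr : s ≤ r) (hN : r < N) (f : SymFun) :
    scalar (twoRowSum θ r s) (R * f) = 0 := by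
  rw [scalar_twoRowSum]
  simp only [scalar_qRow_mul_qRow_mul, hR, ite_mul, zero_mul]
  rcases lt_or_ge (r + s) N with hlt | hge
  · refine sum_eq_zero fun i hi => ?_
    have hi := mem_range.1 hi
    rw [sum_eq_zero, mul_zero]
    intro x hx
    refine sum_eq_zero fun y hy => if_neg ?_
    have := HasAntidiagonal.mem_antidiagonal.1 hx
    have := HasAntidiagonal.mem_antidiagonal.1 hy
    omega
  · obtain ⟨k, hk⟩ := Nat.exists_eq_add_of_le hge
    -- From N > r one gets k = r + s - N < s ≤ r, so the first condition always holds, while the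
    -- second cuts the range at i = s - z.2.
    have hrow : ∀ z ∈ antidiagonal k, (∑ i ∈ range (s + 1), wellPoised θ (r - s) i *
        if z.1 ≤ r + i ∧ z.2 ≤ s - i then
          γ (r + i - z.1) * γ (s - i - z.2) * scalar (qRow z.1 * qRow z.2) f else 0) =
        scalar (qRow z.1 * qRow z.2) f * rowSum θ γ r s z.1 z.2 := by
      intro z hz
      have := HasAntidiagonal.mem_antidiagonal.1 hz
      rw [rowSum, mul_sum]
      symm
      refine sum_subset_zero_on_sdiff (range_subset_range.2 (by omega)) ?_ ?_
      · intro i hi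
        simp only [mem_sdiff, mem_range] at hi
        rw [if_neg (by omega), mul_zero]
      · intro i hi
        simp only [mem_range] at hi
        rw [if_pos (by omega), show s - i - z.2 = s - z.2 - i by omega]
        ring
    have hsum : ∑ i ∈ range (s + 1), wellPoised θ (r - s) i *
        ∑ x ∈ antidiagonal (r + i), ∑ y ∈ antidiagonal (s - i),
          (if x.1 + y.1 = N then γ x.1 * γ y.1 * scalar (qRow x.2 * qRow y.2) f else 0) =
        ∑ z ∈ antidiagonal k, scalar (qRow z.1 * qRow z.2) f * rowSum θ γ r s z.1 z.2 := by
      rw [← sum_congr rfl hrow, sum_comm]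
      refine sum_congr rfl fun i hi => ?_
      have hi := mem_range.1 hi
      rw [sum_antidiagonal_antidiagonal_ite (r + i) (s - i) N k (by omega)
        (fun u v c d => γ u * γ v * scalar (qRow c * qRow d) f), mul_sum]
    rw [hsum]
    -- The coefficients of f are symmetric under exchange of the two variables, so twice the sum is
    -- a sum over the symmetrized `rowSum`.
    have hswap := Finset.Nat.sum_antidiagonal_swap (n := k)
      (f := fun z => scalar (qRow z.1 * qRow z.2) f * rowSum θ γ r s z.1 z.2)
    refine (mul_eq_zero.1 ?_).resolve_left (two_ne_zero (α := F))
    rw [two_mul]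
    nth_rewrite 1 [← hswap]
    rw [← sum_add_distrib]
    refine sum_eq_zero fun z hz => ?_
    have := HasAntidiagonal.mem_antidiagonal.1 hz
    simp only [Prod.fst_swap, Prod.snd_swap]
    rw [mul_comm (qRow z.2), ← mul_add,
      rowSum_add_rowSum_eq_zero hθ hγ r s z.2 z.1 hsr (by omega), mul_zero]

/-! ### Partitions -/

theorem card_eq_sum_rowLen (μ : YoungDiagram) : μ.card = ∑ i ∈ range (μ.colLen 0), μ.rowLen i := by
  have h : ∀ c ∈ μ.cells, c.1 ∈ range (μ.colLen 0) := by
    rintro ⟨i, j⟩ hc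
    rw [mem_range, ← YoungDiagram.mem_iff_lt_colLen]
    exact μ.up_left_mem le_rfl (Nat.zero_le j) hc
  rw [YoungDiagram.card, card_eq_sum_card_fiberwise h]
  exact sum_congr rfl fun i _ => (YoungDiagram.rowLen_eq_card μ).symm

theorem sum_rowLens (μ : YoungDiagram) : (μ.rowLens : Multiset ℕ).sum = μ.card := by
  rw [card_eq_sum_rowLen]
  rfl

theorem rowLen_eq_zero {μ : YoungDiagram} {i : ℕ} (h : μ.colLen 0 ≤ i) : μ.rowLen i = 0 := by
  by_contra h0
  have := YoungDiagram.mem_iff_lt_rowLen.2 (Nat.pos_of_ne_zero h0)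
  rw [YoungDiagram.mem_iff_lt_colLen] at this
  omega

theorem sum_rowLen_eq_card {μ : YoungDiagram} {k : ℕ} (h : μ.colLen 0 ≤ k) :
    ∑ i ∈ range k, μ.rowLen i = μ.card := by
  rw [card_eq_sum_rowLen]
  symm
  refine sum_subset (range_subset_range.2 h) fun i _ hi => rowLen_eq_zero ?_
  simpa using hi

theorem sum_rowLen_le_card (μ : YoungDiagram) (k : ℕ) : ∑ i ∈ range k, μ.rowLen i ≤ μ.card := by
  rw [← sum_rowLen_eq_card (le_max_right k (μ.colLen 0))]
  exact sum_le_sum_of_subset (range_subset_range.2 (le_max_left _ _))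

theorem rowLens_coe_injective {μ ν : YoungDiagram}
    (h : (μ.rowLens : Multiset ℕ) = (ν.rowLens : Multiset ℕ)) : μ = ν := by
  have hl : μ.rowLens = ν.rowLens :=
    (Multiset.coe_eq_coe.1 h).eq_of_sortedGE μ.rowLens_sorted ν.rowLens_sorted
  exact YoungDiagram.equivListRowLens.injective (Subtype.ext hl)

theorem exists_rowLens_eq (s : Multiset ℕ) (hs : ∀ x ∈ s, 0 < x) :
    ∃ μ : YoungDiagram, (μ.rowLens : Multiset ℕ) = s := by
  have hw : (s.sort (· ≥ ·)).SortedGE := List.sortedGE_iff_pairwise.2 (Multiset.pairwise_sort s _)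
  refine ⟨YoungDiagram.ofRowLens (s.sort (· ≥ ·)) hw, ?_⟩
  rw [YoungDiagram.rowLens_ofRowLens_eq_self fun x hx => hs x ((Multiset.mem_sort _).1 hx),
    Multiset.sort_eq]

theorem exists_exps_eq (μ : YoungDiagram) : ∃ e : ℕ →₀ ℕ, exps e = (μ.rowLens : Multiset ℕ) := by
  obtain ⟨e, he⟩ := exists_exponent ((μ.rowLens : Multiset ℕ).map Nat.toPNat')
  refine ⟨e, he.trans ?_⟩
  rw [Multiset.map_map]
  conv_rhs => rw [← Multiset.map_id (μ.rowLens : Multiset ℕ)]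
  refine Multiset.map_congr rfl fun i hi => ?_
  have := μ.pos_of_mem_rowLens i hi
  simp
  omega

theorem pos_of_mem_exps {e : ℕ →₀ ℕ} {x : ℕ} (hx : x ∈ exps e) : 0 < x := by
  obtain ⟨i, hi, rfl⟩ := Multiset.mem_map.1 hx
  exact Nat.pos_of_ne_zero (Finsupp.mem_support_iff.1 hi)

theorem exists_rowLens_eq_exps (e : ℕ →₀ ℕ) :
    ∃ μ : YoungDiagram, (μ.rowLens : Multiset ℕ) = exps e :=
  exists_rowLens_eq _ fun _ hx => pos_of_mem_exps hx

theorem q_eq_qMul (μ : YoungDiagram) : q μ = qMul (μ.rowLens : Multiset ℕ) := by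
  rw [q, qMul, Multiset.map_coe, Multiset.prod_coe]

theorem coeff_m (μ : YoungDiagram) (e : ℕ →₀ ℕ) :
    MvPowerSeries.coeff e (m μ) = if exps e = (μ.rowLens : Multiset ℕ) then 1 else 0 := by
  classical
  change (if _ then (1 : F) else 0) = _
  exact if_congr Iff.rfl rfl rfl

/-! ### Expansion in monomial symmetric functions -/

/-- The partitions of `n`. -/
noncomputable def diagrams (n : ℕ) : Finset YoungDiagram := (finite_card_eq n).toFinset

theorem mem_diagrams {n : ℕ} {μ : YoungDiagram} : μ ∈ diagrams n ↔ μ.card = n := by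
  simp [diagrams]

theorem homog_q (μ : YoungDiagram) : Homog μ.card (q μ) := by
  rw [q_eq_qMul, ← sum_rowLens]
  exact homog_qMul _

theorem toSeries_eq_sum {n : ℕ} {f : SymFun} (hf : Homog n f) :
    toSeries f = ∑ μ ∈ diagrams n, scalar (q μ) f • m μ := by
  classical
  ext e
  obtain ⟨μ, hμ⟩ := exists_rowLens_eq_exps e
  rw [coeff_toSeries, map_sum, ← hμ, ← q_eq_qMul]
  have h : ∀ ν, MvPowerSeries.coeff e (scalar (q ν) f • m ν) =
      if μ = ν then scalar (q ν) f else 0 := by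
    intro ν
    rw [map_smul, coeff_m, ← hμ, smul_eq_mul]
    by_cases h : μ = ν
    · rw [if_pos h, if_pos (by rw [h]), mul_one]
    · rw [if_neg h, if_neg fun h' => h (rowLens_coe_injective h'), mul_zero]
  rw [sum_congr rfl fun ν _ => h ν, sum_ite_eq]
  split_ifs with hn
  · rfl
  · exact scalar_eq_zero_of_homog (homog_q μ) hf (mt mem_diagrams.2 hn)

theorem scalar_q_eq_coeff {μ : YoungDiagram} {e : ℕ →₀ ℕ} (he : exps e = (μ.rowLens : Multiset ℕ))
    (f : SymFun) : scalar (q μ) f = MvPowerSeries.coeff e (toSeries f) := by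
  rw [coeff_toSeries, he, q_eq_qMul]

theorem scalar_q_of_toSeries_eq_m {μ ν : YoungDiagram} {f : SymFun} (hf : toSeries f = m ν)
    [Decidable (μ = ν)] : scalar (q μ) f = if μ = ν then 1 else 0 := by
  obtain ⟨e, he⟩ := exists_exps_eq μ
  rw [scalar_q_eq_coeff he, hf, coeff_m, he]
  exact if_congr ⟨rowLens_coe_injective, fun h => by rw [h]⟩ rfl rfl

theorem card_exps (e : ℕ →₀ ℕ) : (exps e).card = e.support.card := by
  rw [exps, Multiset.card_map, card_val]

/-- The monomial symmetric functions are polynomials in the power sums. -/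
theorem exists_toSeries_eq_m (μ : YoungDiagram) :
    ∃ f : SymFun, Homog μ.card f ∧ toSeries f = m μ := by
  classical
  induction hN : μ.rowLens.length using Nat.strong_induction_on generalizing μ with
  | _ N ih =>
    subst hN
    choose! g hg using ih
    set s : Multiset ℕ+ := (μ.rowLens : Multiset ℕ).map Nat.toPNat' with hs
    have hs' : s.map PNat.val = (μ.rowLens : Multiset ℕ) := by
      rw [hs, Multiset.map_map]
      conv_rhs => rw [← Multiset.map_id (μ.rowLens : Multiset ℕ)]
      refine Multiset.map_congr rfl fun i hi => ?_
      have := μ.pos_of_mem_rowLens i hi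
      simp
      omega
    have hcard : s.card = μ.rowLens.length := by simp [hs]
    set f₀ : SymFun := MvPolynomial.monomial (Multiset.toFinsupp s) 1 with hf₀
    have hser : toSeries f₀ = (s.map powerSumSeries).prod := by
      rw [hf₀, toSeries_monomial, one_smul, Multiset.toFinsupp_toMultiset]
    have hhom : Homog μ.card f₀ := by
      refine MvPolynomial.isWeightedHomogeneous_monomial _ _ _ ?_
      rw [← sum_toMultiset_eq_weight, Multiset.toFinsupp_toMultiset, hs', sum_rowLens]
    -- The power-sum product p_μ contains m_μ with a nonzero coefficient, and otherwise only m_ν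
    -- with fewer parts; this triangularity is what the induction inverts.
    have hcoef : ∀ ν : YoungDiagram, (ν = μ → scalar (q ν) f₀ ≠ 0) ∧
        (ν ≠ μ → scalar (q ν) f₀ ≠ 0 → ν.rowLens.length < μ.rowLens.length) := by
      intro ν
      obtain ⟨e, he⟩ := exists_exps_eq ν
      obtain ⟨n, h1, h2, h3⟩ := coeff_prod_powerSumSeries s e
      rw [scalar_q_eq_coeff he, hser, h1]
      refine ⟨?_, fun hne h0 => ?_⟩
      · rintro rfl
        exact_mod_cast h2 (he.trans hs'.symm)
      · have h0' : n ≠ 0 := by exact_mod_cast h0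
        obtain ⟨h4, h5⟩ := h3 h0'
        rw [← card_exps, he, hcard, Multiset.coe_card] at h4 h5
        refine h4.lt_of_ne fun h => hne (rowLens_coe_injective ?_)
        rw [← he, ← hs']
        exact h5 h
    set c := scalar (q μ) f₀ with hc
    have hc0 : c ≠ 0 := (hcoef μ).1 rfl
    have hgh : ∀ ν ∈ (diagrams μ.card).erase μ,
        Homog μ.card (scalar (q ν) f₀ • g ν.rowLens.length ν) ∧
        toSeries (scalar (q ν) f₀ • g ν.rowLens.length ν) = scalar (q ν) f₀ • m ν := by
      intro ν hν
      have hνc := mem_diagrams.1 (mem_of_mem_erase hν)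
      by_cases h0 : scalar (q ν) f₀ = 0
      · rw [h0, zero_smul, map_zero, zero_smul]
        exact ⟨MvPolynomial.isWeightedHomogeneous_zero _ _ _, rfl⟩
      · obtain ⟨h1, h2⟩ := hg _ ((hcoef ν).2 (ne_of_mem_erase hν) h0) ν rfl
        rw [hνc] at h1
        rw [map_smul, h2, MvPolynomial.smul_eq_C_mul]
        exact ⟨h1.C_mul _, rfl⟩
    refine ⟨c⁻¹ • (f₀ - ∑ ν ∈ (diagrams μ.card).erase μ,
      scalar (q ν) f₀ • g ν.rowLens.length ν), ?_, ?_⟩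
    · rw [MvPolynomial.smul_eq_C_mul]
      exact (hhom.sub (MvPolynomial.IsWeightedHomogeneous.sum _ _ _ fun ν hν => (hgh ν hν).1)).C_mul _
    · rw [map_smul, map_sub, map_sum, sum_congr rfl fun ν hν => (hgh ν hν).2, toSeries_eq_sum hhom,
        ← add_sum_erase _ _ (mem_diagrams.2 (rfl : μ.card = μ.card)), add_sub_cancel_right, smul_smul,
        inv_mul_cancel₀ hc0, one_smul]

/-- The monomial symmetric function as a polynomial in the power sums. -/
noncomputable def mSym (μ : YoungDiagram) : SymFun := (exists_toSeries_eq_m μ).choose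

theorem homog_mSym (μ : YoungDiagram) : Homog μ.card (mSym μ) :=
  (exists_toSeries_eq_m μ).choose_spec.1

theorem toSeries_mSym (μ : YoungDiagram) : toSeries (mSym μ) = m μ :=
  (exists_toSeries_eq_m μ).choose_spec.2

theorem scalar_q_mSym (μ ν : YoungDiagram) [Decidable (μ = ν)] :
    scalar (q μ) (mSym ν) = if μ = ν then 1 else 0 :=
  scalar_q_of_toSeries_eq_m (toSeries_mSym ν)

theorem eq_sum_mSym {n : ℕ} {f : SymFun} (hf : Homog n f) :
    f = ∑ μ ∈ diagrams n, scalar (q μ) f • mSym μ := by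
  apply toSeries_injective
  rw [map_sum]
  simp only [map_smul, toSeries_mSym]
  exact toSeries_eq_sum hf

/-- The span consists of power series; the lifts `mSym` and injectivity of `toSeries` bring it back
to symmetric functions, where the pairing is defined. -/
theorem scalar_eq_zero_of_mem_span {f g : SymFun} {S : Set YoungDiagram}
    (hf : ∀ ν ∈ S, scalar f (mSym ν) = 0) (hg : toSeries g ∈ Submodule.span F (m '' S)) :
    scalar f g = 0 := by
  have hle : Submodule.span F (m '' S) ≤ (LinearMap.ker (pairing f)).map toSeries.toLinearMap := by
    rw [Submodule.span_le]
    rintro _ ⟨ν, hν, rfl⟩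
    exact ⟨mSym ν, hf ν hν, toSeries_mSym ν⟩
  obtain ⟨g', hg', h⟩ := hle hg
  rw [← toSeries_injective h]
  exact hg'

theorem sub_m_mem_span {μ : YoungDiagram} {f : SymFun} (hf : Homog μ.card f)
    (h1 : scalar (q μ) f = 1)
    (h : ∀ ν : YoungDiagram, ν.card = μ.card → ¬ DomLE ν μ → scalar (q ν) f = 0) :
    toSeries f - m μ ∈ Submodule.span F (m '' {ν | DomLT ν μ}) := by
  classical
  rw [toSeries_eq_sum hf, ← add_sum_erase _ _ (mem_diagrams.2 (rfl : μ.card = μ.card)), h1, one_smul,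
    add_sub_cancel_left]
  refine Submodule.sum_mem _ fun ν hν => ?_
  by_cases hd : DomLE ν μ
  · exact Submodule.smul_mem _ _ (Submodule.subset_span ⟨ν, ⟨hd, ne_of_mem_erase hν⟩, rfl⟩)
  · rw [h ν (mem_diagrams.1 (mem_of_mem_erase hν)) hd, zero_smul]
    exact Submodule.zero_mem _

theorem eq_P_of_isJack {μ : YoungDiagram} {f : SymFun} (h : IsJack μ f) : P μ = f :=
  IsJack.unique (Classical.epsilon_spec ⟨f, h⟩) h

/-! ### Two-row partitions -/

theorem mem_twoRow {r s : ℕ} (h : s ≤ r) {i j : ℕ} :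
    (i, j) ∈ twoRow r s h ↔ i = 0 ∧ j < r ∨ i = 1 ∧ j < s := by
  rw [twoRow, YoungDiagram.mem_ofRowLens]
  rcases i with _ | _ | i
  · simp
  · simp
  · simp

theorem rowLen_twoRow {r s : ℕ} (h : s ≤ r) (i : ℕ) :
    (twoRow r s h).rowLen i = if i = 0 then r else if i = 1 then s else 0 := by
  refine eq_of_forall_lt_iff fun j => ?_
  rw [← YoungDiagram.mem_iff_lt_rowLen, mem_twoRow]
  split_ifs <;> omega

theorem colLen_twoRow {r s : ℕ} (h : s ≤ r) (j : ℕ) :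
    (twoRow r s h).colLen j = (if j < r then 1 else 0) + if j < s then 1 else 0 := by
  refine eq_of_forall_lt_iff fun i => ?_
  rw [← YoungDiagram.mem_iff_lt_colLen, mem_twoRow]
  split_ifs <;> omega

theorem card_twoRow {r s : ℕ} (h : s ≤ r) : (twoRow r s h).card = r + s := by
  have h2 : (twoRow r s h).colLen 0 ≤ 2 := by
    rw [colLen_twoRow]
    split_ifs <;> omega
  rw [← sum_rowLen_eq_card h2]
  simp [sum_range_succ, rowLen_twoRow]

theorem card_transpose (μ : YoungDiagram) : μ.transpose.card = μ.card := by
  simp [YoungDiagram.card, YoungDiagram.transpose]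

theorem q_eq_prod_range {μ : YoungDiagram} {k : ℕ} (h : μ.colLen 0 ≤ k) :
    q μ = ∏ i ∈ range k, qRow (μ.rowLen i) := by
  have hq : q μ = ∏ i ∈ range (μ.colLen 0), qRow (μ.rowLen i) := by
    rw [q, YoungDiagram.rowLens, List.map_map]
    rfl
  rw [hq]
  refine prod_subset (range_subset_range.2 h) fun i _ hi => ?_
  rw [rowLen_eq_zero (by simpa using hi), qRow_zero]

theorem q_twoRow {r s : ℕ} (h : s ≤ r) : q (twoRow r s h) = qRow r * qRow s := by
  have h2 : (twoRow r s h).colLen 0 ≤ 2 := by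
    rw [colLen_twoRow]
    split_ifs <;> omega
  rw [q_eq_prod_range h2]
  simp [prod_range_succ, rowLen_twoRow]

/-- Only the first partial sum is a condition: from the second on, the partial sums of (r, s) equal
the total weight. -/
theorem domLE_twoRow {r s : ℕ} (h : s ≤ r) {ν : YoungDiagram} (hc : ν.card = r + s)
    (h0 : ν.rowLen 0 ≤ r) : DomLE ν (twoRow r s h) := by
  refine ⟨by rw [card_twoRow, hc], fun k => ?_⟩
  rcases k with _ | _ | k
  · simp
  · simpa [rowLen_twoRow] using h0
  · have h2 : (twoRow r s h).colLen 0 ≤ k + 1 + 1 := by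
      rw [colLen_twoRow]
      split_ifs <;> omega
    rw [sum_rowLen_eq_card h2, card_twoRow, ← hc]
    exact sum_rowLen_le_card _ _

theorem sum_rowLen_transpose_twoRow {r s : ℕ} (h : s ≤ r) (k : ℕ) :
    ∑ i ∈ range k, (twoRow r s h).transpose.rowLen i = min k r + min k s := by
  induction k with
  | zero => simp
  | succ k ih =>
    rw [sum_range_succ, ih, YoungDiagram.rowLen_transpose, colLen_twoRow]
    split_ifs <;> omega

theorem domLE_of_colLen_le {r s : ℕ} (h : s ≤ r) {ν : YoungDiagram} (hc : ν.card = r + s)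
    (h0 : ν.colLen 0 ≤ r) : DomLE (twoRow r s h).transpose ν := by
  refine ⟨by rw [card_transpose, card_twoRow, hc], fun k => ?_⟩
  rw [sum_rowLen_transpose_twoRow]
  rcases le_or_gt (ν.colLen 0) k with hk | hk
  · rw [sum_rowLen_eq_card hk, hc]
    omega
  · rcases k with _ | k
    · simp
    · have hpos : ∀ i, i < ν.colLen 0 → 1 ≤ ν.rowLen i := fun i hi =>
        YoungDiagram.mem_iff_lt_rowLen.1 (YoungDiagram.mem_iff_lt_colLen.2 hi)
      rcases lt_or_ge 1 (ν.rowLen k) with h2 | h1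
      · have : ∑ i ∈ range (k + 1), 2 ≤ ∑ i ∈ range (k + 1), ν.rowLen i :=
          sum_le_sum fun i hi => (show 2 ≤ ν.rowLen k from h2).trans
            (ν.rowLen_anti i k (by have := mem_range.1 hi; omega))
        simp only [sum_const, card_range, smul_eq_mul] at this
        omega
      · have hsplit := sum_range_add_sum_Ico (fun i => ν.rowLen i) hk.le
        rw [sum_rowLen_eq_card le_rfl, hc] at hsplit
        have hle : ∑ i ∈ Ico (k + 1) (ν.colLen 0), ν.rowLen i ≤
            ∑ i ∈ Ico (k + 1) (ν.colLen 0), 1 :=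
          sum_le_sum fun i hi => (ν.rowLen_anti k i (by have := mem_Ico.1 hi; omega)).trans h1
        simp only [sum_const, Nat.card_Ico, smul_eq_mul, mul_one] at hle
        omega

/-- Multiplying numerator and denominator by α turns the term ratio at θ = 1/α into that of a_i;
each replacement of j - 1/α by 1 - jα supplies one of the signs. The indices 0 and 1 start the
recursion separately. -/
theorem aCoeff_eq_wellPoised (a i : ℕ) : aCoeff a i = wellPoised α⁻¹ a i := by
  have hα := α_ne_zero
  have hd : ∀ n : ℕ, ∏ j ∈ Icc 1 n, (1 + ((a : F) + j) * α) ≠ 0 := fun n =>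
    prod_ne_zero_iff.2 fun j _ => by
      have := one_add_nat_mul_α_ne_zero (a + j)
      push_cast at this
      exact this
  rcases i with _ | i
  · simp [aCoeff, wellPoised]
  induction i with
  | zero =>
    have h1 := one_add_nat_mul_α_ne_zero (a + 1)
    have h2 := nat_add_inv_α_ne_zero (a + 1)
    push_cast at h1 h2
    have h3 : (a : F) + 1 + α⁻¹ = (1 + (a + 1) * α) * α⁻¹ := by field_simp; ring
    simp only [aCoeff, wellPoised]
    rw [h3]
    simp
    field_simp
    ring
  | succ i ih =>
    rw [wellPoised, ← ih]
    have h1 := one_add_nat_mul_α_ne_zero (a + i + 2)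
    push_cast at h1
    have h3 : (a : F) + i + 2 + α⁻¹ = (1 + (a + i + 2) * α) * α⁻¹ := by field_simp; ring
    have h4 : (a : F) + 2 * i + 2 ≠ 0 := by exact_mod_cast Nat.succ_ne_zero (a + 2 * i + 1)
    have h5 : (i : F) + 2 ≠ 0 := by exact_mod_cast Nat.succ_ne_zero (i + 1)
    have h6 : ((i + 1).factorial : F) ≠ 0 := by exact_mod_cast (i + 1).factorial_ne_zero
    have h7 := hd (i + 1)
    simp only [aCoeff, if_neg (Nat.succ_ne_zero _), Nat.add_sub_cancel]
    rw [prod_Icc_succ_top (by omega) (fun j => (a : F) + j),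
      prod_Icc_succ_top (by omega) (fun j => 1 - (j : F) * α),
      prod_Icc_succ_top (by omega : 1 ≤ i + 1 + 1), Nat.factorial_succ (i + 1), h3]
    have h8 : (1 : F) + (a + ((i + 1 + 1 : ℕ) : F)) * α ≠ 0 := by
      push_cast; convert h1 using 1; ring
    push_cast at h7 h8 ⊢
    rw [show (1 : F) + (a + (i + 1 + 1)) * α = 1 + (a + i + 2) * α by ring,
      show (i : F) + 1 + 1 = i + 2 by ring, show (a : F) + 2 * (i + 1) = a + 2 * i + 2 by ring]
    generalize ∏ j ∈ Icc 1 (i + 1), ((1 : F) + (a + j) * α) = D at *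
    generalize ∏ j ∈ Icc 1 i, ((1 : F) - j * α) = E
    generalize ∏ j ∈ Icc 1 i, ((a : F) + j) = G
    field_simp
    ring

theorem Homog.smul {n : ℕ} {f : SymFun} (hf : Homog n f) (c : F) : Homog n (c • f) := by
  rw [MvPolynomial.smul_eq_C_mul]
  exact hf.C_mul c

theorem homog_twoRowSum (θ : F) (r s : ℕ) : Homog (r + s) (twoRowSum θ r s) := by
  refine MvPolynomial.IsWeightedHomogeneous.sum _ _ _ fun i hi => ?_
  have h := (homog_qRow (r + i)).mul (homog_qRow (s - i))
  rw [show r + i + (s - i) = r + s by have := mem_range.1 hi; omega] at h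
  exact Homog.smul h _

/-! ### Two-row Jack functions -/

theorem sub_le_add_of_le {r s : ℕ} (h : s ≤ r) (i : ℕ) : s - i ≤ r + i := by omega

theorem scalar_twoRowSum_q_eq_zero {r s : ℕ} (hsr : s ≤ r) {ν : YoungDiagram}
    (hν : r < ν.rowLen 0) : scalar (q ν) (twoRowSum α⁻¹ r s) = 0 := by
  have hγ := isRising_rowCoeff 1
  rw [mul_one] at hγ
  -- The product is extended by a trivial factor q_0 so that the factor of the first row can be
  -- split off.
  rw [scalar_comm, q_eq_prod_range (Nat.le_succ (ν.colLen 0)), prod_range_succ', mul_comm]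
  refine scalar_twoRowSum_mul_eq_zero nat_add_inv_α_ne_zero hγ (fun u v => ?_) hsr hν _
  have := scalar_qRow_mul_qRow_rescale (fun _ => 1) (ν.rowLen 0) u v
  rwa [rescale_one] at this

theorem scalar_twoRowSum_eq_sum_q {r s : ℕ} (hsr : s ≤ r) (θ : F) (g : SymFun) :
    scalar (twoRowSum θ r s) g = ∑ i ∈ range (s + 1),
      wellPoised θ (r - s) i * scalar (q (twoRow (r + i) (s - i) (sub_le_add_of_le hsr i))) g := by
  rw [scalar_twoRowSum]
  exact sum_congr rfl fun i _ => by rw [q_twoRow]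

/-- If `g` has no component on the `m_μ` with `μ₁ > r`, only the first term contributes. -/
theorem scalar_twoRowSum_eq {r s : ℕ} (hsr : s ≤ r) (θ : F) {g : SymFun}
    (hg : ∀ i, 0 < i → i ≤ s → scalar (q (twoRow (r + i) (s - i) (sub_le_add_of_le hsr i))) g = 0) :
    scalar (twoRowSum θ r s) g = scalar (q (twoRow r s hsr)) g := by
  rw [scalar_twoRowSum_eq_sum_q hsr, sum_eq_single 0]
  · simp [wellPoised]
  · intro i hi h0
    rw [hg i (Nat.pos_of_ne_zero h0) (by have := mem_range.1 hi; omega), mul_zero]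
  · simp

theorem twoRow_rowLen_zero {r s : ℕ} (h : s ≤ r) : (twoRow r s h).rowLen 0 = r := by
  simp [rowLen_twoRow]

theorem twoRow_injective {r s r' s' : ℕ} {h : s ≤ r} {h' : s' ≤ r'}
    (he : twoRow r s h = twoRow r' s' h') : r = r' := by
  rw [← twoRow_rowLen_zero h, he, twoRow_rowLen_zero]

/-- The number equals ⟨T, T⟩ for the sum T, because the other terms of T pair to zero with T. It is
nonzero since the form is anisotropic and T pairs to 1 with the monomial function of (r, s). -/
theorem scalar_twoRowSum_self_ne_zero {r s : ℕ} (hsr : s ≤ r) :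
    scalar (q (twoRow r s hsr)) (twoRowSum α⁻¹ r s) ≠ 0 := by
  classical
  have h1 : scalar (twoRowSum α⁻¹ r s) (mSym (twoRow r s hsr)) = 1 := by
    rw [scalar_twoRowSum_eq hsr, scalar_q_mSym, if_pos rfl]
    intro i hi _
    rw [scalar_q_mSym, if_neg]
    intro h
    have := twoRow_injective h
    omega
  rw [← scalar_twoRowSum_eq hsr α⁻¹]
  · intro h0
    rw [eq_zero_of_scalar_self h0, scalar_zero_left] at h1
    exact zero_ne_one h1
  · intro i hi _
    exact scalar_twoRowSum_q_eq_zero hsr (by rw [twoRow_rowLen_zero]; omega)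

theorem scalar_q_eq_zero_of_mem_span {g : SymFun} {S : Set YoungDiagram}
    (hg : toSeries g ∈ Submodule.span F (m '' S)) {κ : YoungDiagram} (hκ : κ ∉ S) :
    scalar (q κ) g = 0 := by
  classical
  refine scalar_eq_zero_of_mem_span (fun ν hν => ?_) hg
  rw [scalar_q_mSym, if_neg]
  rintro rfl
  exact hκ hν

/-- Triangularity is the vanishing theorem. Orthogonality holds because every q-product in the sum
belongs to a partition dominating (r, s). -/
theorem isJack_twoRow {r s : ℕ} (hsr : s ≤ r) :
    IsJack (twoRow r s hsr)
      ((scalar (q (twoRow r s hsr)) (twoRowSum α⁻¹ r s))⁻¹ • twoRowSum α⁻¹ r s) := by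
  refine ⟨sub_m_mem_span ?_ ?_ ?_, ?_⟩
  · rw [card_twoRow]
    exact (homog_twoRowSum _ _ _).smul _
  · rw [scalar_smul_right, inv_mul_cancel₀ (scalar_twoRowSum_self_ne_zero hsr)]
  · intro ν hc hν
    rw [card_twoRow] at hc
    rw [scalar_smul_right, scalar_twoRowSum_q_eq_zero (ν := ν) hsr, mul_zero]
    by_contra h
    exact hν (domLE_twoRow hsr hc (not_lt.1 h))
  · intro g hg
    have h0 : ∀ i, (hi : i ≤ s) → scalar (q (twoRow (r + i) (s - i) (sub_le_add_of_le hsr i))) g = 0 :=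
      fun i hi => scalar_q_eq_zero_of_mem_span hg fun h => h
        (domLE_twoRow _ (by rw [card_twoRow]; omega) (by rw [twoRow_rowLen_zero]; omega))
    rw [scalar_smul_left, scalar_twoRowSum_eq hsr _ fun i _ hi => h0 i hi]
    have := h0 0 (Nat.zero_le s)
    simp only [add_zero, Nat.sub_zero] at this
    rw [this, mul_zero]

/-- If c is the leading coefficient of T, then P = T/c and ⟨T, T⟩ = c, so ⟨P, P⟩ = 1/c and the two
scalars cancel. -/
theorem Q_twoRow {r s : ℕ} (hsr : s ≤ r) : Q (twoRow r s hsr) = twoRowSum α⁻¹ r s := by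
  have hc := scalar_twoRowSum_self_ne_zero hsr
  rw [Q, eq_P_of_isJack (isJack_twoRow hsr), scalar_smul_left, scalar_smul_right,
    scalar_twoRowSum_eq hsr, inv_mul_cancel₀ hc, mul_one, inv_inv, smul_smul, mul_inv_cancel₀ hc,
    one_smul]
  intro i hi _
  exact scalar_twoRowSum_q_eq_zero hsr (by rw [twoRow_rowLen_zero]; omega)

/-! ### Elementary symmetric functions -/

/-- The elementary symmetric function `e_n`. -/
noncomputable def eSym (n : ℕ) : SymFun := rescale signScale (qRow n)

theorem homog_eSym (n : ℕ) : Homog n (eSym n) := (homog_qRow n).rescale _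

/-- The one-variable series is 1 + x, so only squarefree monomials survive; this identifies the
rescaled q_n with e_n. -/
theorem coeff_toSeries_eSym (n : ℕ) (e : ℕ →₀ ℕ) :
    MvPowerSeries.coeff e (toSeries (eSym n)) = if exps e = Multiset.replicate n 1 then 1 else 0 := by
  rw [coeff_toSeries, eSym, scalar_qMul_rescale_qRow]
  split_ifs with h1 h2 h2
  · rw [h2, Multiset.map_replicate, rowCoeff_signScale_one, Multiset.prod_replicate, one_pow]
  · by_cases hx : ∃ x ∈ exps e, 2 ≤ x
    · obtain ⟨x, hx, h⟩ := hx
      exact Multiset.prod_eq_zero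
        (Multiset.mem_map.2 ⟨x, hx, rowCoeff_signScale_of_two_le x h⟩)
    · refine absurd ?_ h2
      push Not at hx
      have h3 : exps e = Multiset.replicate (exps e).card 1 :=
        Multiset.eq_replicate_card.2 fun x hx' => by
          have := hx x hx'
          have := pos_of_mem_exps hx'
          omega
      rw [h3, Multiset.sum_replicate, smul_eq_mul, mul_one] at h1
      rwa [h1] at h3
  · rw [h2] at h1
    simp at h1
  · rfl

/-- The exponents of a monomial, all lowered by one. -/
noncomputable def lower (e : ℕ →₀ ℕ) : ℕ →₀ ℕ := e.mapRange Nat.pred rfl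

theorem exps_lower (e : ℕ →₀ ℕ) :
    exps (lower e) = ((exps e).map Nat.pred).filter (· ≠ 0) := by
  classical
  have hs : (lower e).support = e.support.filter fun i => (e i).pred ≠ 0 := by
    ext i
    simp only [lower, Finsupp.mem_support_iff, Finsupp.mapRange_apply, mem_filter]
    refine ⟨fun h => ⟨?_, h⟩, fun h => h.2⟩
    intro h0
    rw [h0] at h
    exact h rfl
  rw [exps, exps, hs, Multiset.map_map, Multiset.filter_map, filter_val]
  rfl

/-- Lowering all parts by one and dropping zeros forgets only the number of ones, which the number
of parts restores. -/
theorem eq_of_filter_pred_eq {s t : Multiset ℕ} (hs : ∀ x ∈ s, 0 < x) (ht : ∀ x ∈ t, 0 < x)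
    (hc : s.card = t.card)
    (h : (s.map Nat.pred).filter (· ≠ 0) = (t.map Nat.pred).filter (· ≠ 0)) : s = t := by
  have hsucc : ∀ {s : Multiset ℕ}, (∀ x ∈ s, 0 < x) → (s.map Nat.pred).map Nat.succ = s := by
    intro s hs
    rw [Multiset.map_map]
    conv_rhs => rw [← Multiset.map_id s]
    exact Multiset.map_congr rfl fun x hx => Nat.succ_pred_eq_of_pos (hs x hx)
  have hrep : ∀ s : Multiset ℕ, s.filter (¬ · ≠ 0) =
      Multiset.replicate (s.card - (s.filter (· ≠ 0)).card) 0 := by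
    intro s
    have h1 := congrArg Multiset.card (Multiset.filter_add_not (fun x => x ≠ 0) s)
    rw [Multiset.card_add] at h1
    refine Multiset.eq_replicate.2 ⟨by omega, fun x hx => ?_⟩
    simpa using (Multiset.mem_filter.1 hx).2
  rw [← hsucc hs, ← hsucc ht]
  congr 1
  rw [← Multiset.filter_add_not (fun x => x ≠ 0) (s.map Nat.pred),
    ← Multiset.filter_add_not (fun x => x ≠ 0) (t.map Nat.pred), hrep, hrep, h,
    Multiset.card_map, Multiset.card_map, hc]

theorem length_rowLens_eq {μ : YoungDiagram} {e : ℕ →₀ ℕ}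
    (he : exps e = (μ.rowLens : Multiset ℕ)) : e.support.card = μ.colLen 0 := by
  rw [← card_exps, he, Multiset.coe_card, YoungDiagram.length_rowLens]

/-- A monomial in at most n variables has a squarefree divisor of degree n only if it has exactly n
variables, and then the divisor is their product. -/
theorem coeff_eSym_mul {n : ℕ} {e : ℕ →₀ ℕ} (hn : e.support.card ≤ n) (g : SymFun) :
    MvPowerSeries.coeff e (toSeries (eSym n * g)) =
      if e.support.card = n then MvPowerSeries.coeff (lower e) (toSeries g) else 0 := by
  classical
  rw [map_mul, MvPowerSeries.coeff_mul]
  have hx : ∀ x ∈ antidiagonal e, exps x.1 = Multiset.replicate n 1 →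
      e.support.card = n ∧ x.2 = lower e := by
    rintro ⟨x, y⟩ hxy h
    have hxy : x + y = e := HasAntidiagonal.mem_antidiagonal.1 hxy
    have hsub : x.support ⊆ e.support := by
      rw [← hxy]
      exact Finsupp.support_mono (by simp)
    have hcard : x.support.card = n := by
      rw [← card_exps]
      simp only at h
      rw [h, Multiset.card_replicate]
    have hle := card_le_card hsub
    have heq := eq_of_subset_of_card_le hsub (by omega)
    refine ⟨by omega, ?_⟩
    ext i
    have hi := DFunLike.congr_fun hxy i
    rw [Finsupp.add_apply] at hi
    simp only [lower, Finsupp.mapRange_apply]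
    by_cases h0 : i ∈ e.support
    · have h1 : x i = 1 := by
        refine Multiset.eq_of_mem_replicate (n := n) ?_
        rw [← h]
        exact Multiset.mem_map_of_mem _ (heq ▸ h0 : i ∈ x.support)
      rw [Nat.pred_eq_sub_one]
      omega
    · rw [Finsupp.notMem_support_iff.1 h0] at hi ⊢
      rw [Nat.pred_zero]
      omega
  split_ifs with hc
  · set x₀ : ℕ →₀ ℕ := e - lower e with hx₀
    have hval : ∀ i ∈ e.support, x₀ i = 1 := by
      intro i hi
      have := Finsupp.mem_support_iff.1 hi
      simp only [hx₀, lower, Finsupp.tsub_apply, Finsupp.mapRange_apply, Nat.pred_eq_sub_one]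
      omega
    have hsupp : x₀.support = e.support := by
      ext i
      refine ⟨fun h => ?_, fun h => by rw [Finsupp.mem_support_iff, hval i h]; exact one_ne_zero⟩
      exact Finsupp.support_mono (tsub_le_self : e - lower e ≤ e) h
    have hexp : exps x₀ = Multiset.replicate n 1 := by
      refine Multiset.eq_replicate.2 ⟨by rw [card_exps, hsupp, hc], fun y hy => ?_⟩
      obtain ⟨i, hi, rfl⟩ := Multiset.mem_map.1 hy
      exact hval i (hsupp ▸ hi : i ∈ e.support)
    have hle : lower e ≤ e := fun i => by
      simp only [lower, Finsupp.mapRange_apply]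
      exact Nat.pred_le _
    rw [sum_eq_single (x₀, lower e)]
    · rw [coeff_toSeries_eSym, if_pos hexp, one_mul]
    · rintro ⟨x, y⟩ hxy hne
      rw [coeff_toSeries_eSym]
      split_ifs with h
      · obtain ⟨-, h2⟩ := hx _ hxy h
        refine absurd (Prod.ext ?_ h2) hne
        have h2 : y = lower e := h2
        have hxy : x + y = e := HasAntidiagonal.mem_antidiagonal.1 hxy
        simp only [hx₀]
        rw [← h2, ← hxy, add_tsub_cancel_right]
      · rw [zero_mul]
    · intro h
      exact absurd (HasAntidiagonal.mem_antidiagonal.2 (tsub_add_cancel_of_le hle)) h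
  · refine sum_eq_zero fun x hx' => ?_
    rw [coeff_toSeries_eSym, if_neg fun h => hc (hx x hx' h).1, zero_mul]

/-- A functional that kills all multiples of the `e_n` with `n > r` kills all `m_ν` with more than
`r` parts. -/
theorem scalar_mSym_eq_zero {f : SymFun} {r : ℕ}
    (hf : ∀ n, r < n → ∀ g, scalar f (eSym n * g) = 0) {ν : YoungDiagram} (hν : r < ν.colLen 0) :
    scalar f (mSym ν) = 0 := by
  classical
  have hlen : ∀ μ : YoungDiagram, μ.colLen 0 ≤ μ.card := by
    intro μ
    rw [card_eq_sum_rowLen]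
    calc μ.colLen 0 = ∑ i ∈ range (μ.colLen 0), 1 := by simp
      _ ≤ _ := sum_le_sum fun i hi => YoungDiagram.mem_iff_lt_rowLen.1
        (YoungDiagram.mem_iff_lt_colLen.2 (mem_range.1 hi))
  induction hN : ν.card - ν.colLen 0 using Nat.strong_induction_on generalizing ν with
  | _ N ih =>
    obtain ⟨e, he⟩ := exists_exps_eq ν
    obtain ⟨κ, hκ⟩ := exists_rowLens_eq_exps (lower e)
    -- If κ is ν with its first column removed, then e_{l(ν)} m_κ is m_ν plus terms with more parts,
    -- to which the induction on |ν| - l(ν) applies.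
    set h : SymFun := eSym (ν.colLen 0) * mSym κ with hh
    have hcoef : ∀ μ : YoungDiagram, μ.colLen 0 ≤ ν.colLen 0 →
        scalar (q μ) h = if μ = ν then 1 else 0 := by
      intro μ hμ
      obtain ⟨e', he'⟩ := exists_exps_eq μ
      have hc := length_rowLens_eq he'
      rw [scalar_q_eq_coeff he', hh, coeff_eSym_mul (hc.trans_le hμ), toSeries_mSym, coeff_m, hκ,
        ← ite_and]
      refine if_congr ⟨?_, ?_⟩ rfl rfl
      · rintro ⟨h1, h2⟩
        rw [exps_lower, exps_lower] at h2
        apply rowLens_coe_injective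
        rw [← he, ← he']
        refine eq_of_filter_pred_eq (fun _ => pos_of_mem_exps) (fun _ => pos_of_mem_exps) ?_ h2
        rw [card_exps, card_exps, h1, length_rowLens_eq he]
      · rintro rfl
        refine ⟨hc, ?_⟩
        rw [exps_lower, exps_lower, he, he']
    have hcard : ν.colLen 0 + κ.card = ν.card := by
      have h1 : scalar (q ν) h ≠ 0 := by
        rw [hcoef ν le_rfl, if_pos rfl]
        exact one_ne_zero
      by_contra hne
      exact h1 (scalar_eq_zero_of_homog (homog_q ν) ((homog_eSym _).mul (homog_mSym κ))
        (Ne.symm hne))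
    have hhom : Homog ν.card h := by
      rw [← hcard]
      exact (homog_eSym _).mul (homog_mSym κ)
    have h0 := hf _ hν (mSym κ)
    rw [← hh, eq_sum_mSym hhom, scalar_sum_right,
      ← add_sum_erase _ _ (mem_diagrams.2 (rfl : ν.card = ν.card)), scalar_smul_right,
      hcoef ν le_rfl, if_pos rfl, one_mul, sum_eq_zero, add_zero] at h0
    · exact h0
    · intro μ hμ
      have hμc := mem_diagrams.1 (mem_of_mem_erase hμ)
      rw [scalar_smul_right]
      rcases le_or_gt (μ.colLen 0) (ν.colLen 0) with hle | hlt
      · rw [hcoef μ hle, if_neg (ne_of_mem_erase hμ), zero_mul]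
      · rw [ih (μ.card - μ.colLen 0) (by have := hlen μ; omega) (hν.trans hlt) rfl, mul_zero]

/-! ### Two-column Jack functions -/

theorem restrict₂_eSym_one :
    restrict₂ (eSym 1) = Polynomial.X + Polynomial.C Polynomial.X := by
  ext a b
  rw [coeff_restrict₂, eSym, scalar_qRow_mul_qRow_rescale, Polynomial.coeff_add,
    Polynomial.coeff_add, Polynomial.coeff_X, Polynomial.coeff_C]
  rcases a with _ | _ | a
  · rcases b with _ | _ | b
    · simp
    · simp [rowCoeff_signScale_one, rowCoeff_zero]
    · simp [Polynomial.coeff_X]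
  · rcases b with _ | b
    · simp [rowCoeff_signScale_one, rowCoeff_zero]
    · simp [Polynomial.coeff_one]
  · rw [if_neg (by omega)]
    simp

theorem restrict₂_eSym_two :
    restrict₂ (eSym 2) = Polynomial.X * Polynomial.C Polynomial.X := by
  ext a b
  rw [coeff_restrict₂, eSym, scalar_qRow_mul_qRow_rescale, Polynomial.coeff_mul_C,
    Polynomial.coeff_X]
  rcases a with _ | _ | a
  · rcases eq_or_ne b 2 with rfl | hb
    · simp [rowCoeff_signScale_of_two_le]
    · simp [hb]
  · rcases eq_or_ne b 1 with rfl | hb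
    · simp [rowCoeff_signScale_one]
    · rw [if_neg (by omega), if_pos rfl, one_mul, Polynomial.coeff_X, if_neg hb.symm]
  · rw [rowCoeff_signScale_of_two_le (a + 1 + 1) (by omega)]
    simp

theorem restrict₂_eSym_of_three_le {n : ℕ} (hn : 3 ≤ n) : restrict₂ (eSym n) = 0 := by
  ext a b
  rw [coeff_restrict₂, eSym, scalar_qRow_mul_qRow_rescale]
  split_ifs with h
  · rcases le_or_gt 2 a with ha | ha
    · simp [rowCoeff_signScale_of_two_le a ha]
    · simp [rowCoeff_signScale_of_two_le b (by omega)]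
  · simp

theorem rescale_qMul (s : Multiset ℕ) : rescale signScale (qMul s) = (s.map eSym).prod := by
  rw [qMul, map_multiset_prod, Multiset.map_map]
  rfl

/-- Self-adjointness of the scaling moves it to the other factor: the coefficient of m_s in e_a e_b
is the coefficient of x^a y^b in the product of the e_n(x, y). As e_n(x, y) = 0 for n ≥ 3, only
parts at most 2 occur. -/
theorem scalar_qMul_eSym_mul_eSym (s : Multiset ℕ) (a b : ℕ) :
    scalar (qMul s) (eSym a * eSym b) =
      ((s.map fun n => restrict₂ (eSym n)).prod.coeff a).coeff b := by
  have h : (s.map fun n => restrict₂ (eSym n)).prod = restrict₂ (rescale signScale (qMul s)) := by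
    rw [rescale_qMul, map_multiset_prod, Multiset.map_map]
    rfl
  rw [h, coeff_restrict₂, eSym, eSym, ← map_mul, ← scalar_rescale, scalar_comm]

theorem scalar_qMul_eSym_mul_eSym_eq_zero {s : Multiset ℕ} {n : ℕ} (hn : n ∈ s) (h3 : 3 ≤ n)
    (a b : ℕ) : scalar (qMul s) (eSym a * eSym b) = 0 := by
  rw [scalar_qMul_eSym_mul_eSym, Multiset.prod_eq_zero (Multiset.mem_map.2 ⟨n, hn,
    restrict₂_eSym_of_three_le h3⟩)]
  simp

/-- This is the coefficient of x^a y^b in (xy)^B (x+y)^A. -/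
theorem scalar_qMul_twos_ones (A B a b : ℕ) (h : a + b = 2 * B + A) :
    scalar (qMul (Multiset.replicate B 2 + Multiset.replicate A 1)) (eSym a * eSym b) =
      if B ≤ b then (A.choose (b - B) : F) else 0 := by
  rw [scalar_qMul_eSym_mul_eSym, Multiset.map_add, Multiset.map_replicate, Multiset.map_replicate,
    Multiset.prod_add, Multiset.prod_replicate, Multiset.prod_replicate, restrict₂_eSym_one,
    restrict₂_eSym_two, mul_pow, ← Polynomial.C_pow, mul_assoc, Polynomial.coeff_X_pow_mul']
  split_ifs with h1 h2 h2
  · rw [Polynomial.coeff_C_mul, Polynomial.coeff_X_pow_mul', if_pos h2, Polynomial.coeff_X_add_C_pow,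
      ← Polynomial.C_eq_natCast, Polynomial.coeff_mul_C, Polynomial.coeff_X_pow]
    rcases le_or_gt (a - B) A with hA | hA
    · rw [if_pos (by omega), one_mul, ← Nat.choose_symm hA, show A - (a - B) = b - B by omega]
    · omega
  · rw [Polynomial.coeff_C_mul, Polynomial.coeff_X_pow_mul', if_neg h2]
  · rw [Polynomial.coeff_zero, Nat.choose_eq_zero_of_lt (by omega), Nat.cast_zero]
  · simp

theorem rowLens_transpose_twoRow {r s : ℕ} (h : s ≤ r) :
    ((twoRow r s h).transpose.rowLens : Multiset ℕ) =
      Multiset.replicate s 2 + Multiset.replicate (r - s) 1 := by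
  have h1 : (twoRow r s h).transpose.rowLens =
      (List.range r).map fun i => if i < s then 2 else 1 := by
    rw [YoungDiagram.rowLens, YoungDiagram.colLen_transpose, twoRow_rowLen_zero]
    refine List.map_congr_left fun i hi => ?_
    have := List.mem_range.1 hi
    rw [YoungDiagram.rowLen_transpose, colLen_twoRow, if_pos this]
    split_ifs <;> rfl
  have h2 : (twoRow r s h).transpose.rowLens = List.replicate s 2 ++ List.replicate (r - s) 1 := by
    rw [h1]
    refine List.ext_getElem (by simp; omega) fun i hi hi' => ?_
    rw [List.getElem_map, List.getElem_range, List.getElem_append]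
    simp
  rw [h2, ← Multiset.coe_add, Multiset.coe_replicate, Multiset.coe_replicate]

theorem exists_eq_transpose_twoRow {μ : YoungDiagram} (h : ∀ x ∈ μ.rowLens, x ≤ 2) :
    ∃ a b, ∃ hab : b ≤ a, μ = (twoRow a b hab).transpose := by
  set s : Multiset ℕ := (μ.rowLens : Multiset ℕ) with hs
  have hx : ∀ x ∈ s, x = 2 ∨ x = 1 := by
    intro x hx
    have h1 := μ.pos_of_mem_rowLens x hx
    have h2 := h x hx
    omega
  refine ⟨s.card, s.count 2, Multiset.count_le_card _ _, rowLens_coe_injective ?_⟩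
  rw [rowLens_transpose_twoRow, ← hs]
  have h2 : s.filter (· = 2) = Multiset.replicate (s.count 2) 2 := Multiset.filter_eq' s 2
  have h1 : s.filter (¬ · = 2) = Multiset.replicate (s.card - s.count 2) 1 := by
    have hc := congrArg Multiset.card (Multiset.filter_add_not (fun x => x = 2) s)
    rw [Multiset.card_add, h2, Multiset.card_replicate] at hc
    refine Multiset.eq_replicate.2 ⟨by omega, fun x hx' => ?_⟩
    obtain ⟨h3, h4⟩ := Multiset.mem_filter.1 hx'
    exact (hx x h3).resolve_left h4
  rw [← h2, ← h1, Multiset.filter_add_not]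

/-- The two-column Jack function as a combination of products of elementary symmetric functions. -/
noncomputable def twoColumn (r s : ℕ) : SymFun := rescale signScale (twoRowSum α r s)

theorem homog_twoColumn (r s : ℕ) : Homog (r + s) (twoColumn r s) :=
  (homog_twoRowSum _ _ _).rescale _

theorem twoColumn_eq_sum (r s : ℕ) : twoColumn r s =
    ∑ i ∈ range (s + 1), wellPoised α (r - s) i • (eSym (r + i) * eSym (s - i)) := by
  simp only [twoColumn, twoRowSum, map_sum, map_smul, map_mul, eSym]

/-- Applied to e_n, the scaling loses its signs and becomes p_k ↦ α² p_k on q_n. Its exponent is θ =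
α⁻¹ α² = α, matching the parameter of the column coefficients. -/
theorem scalar_twoColumn_eSym_mul {r s n : ℕ} (hsr : s ≤ r) (hn : r < n) (g : SymFun) :
    scalar (twoColumn r s) (eSym n * g) = 0 := by
  have hscale : rescale signScale (eSym n) = rescale (fun _ => α ^ 2) (qRow n) := by
    rw [eSym, rescale_rescale]
    congr 2
    funext k
    rw [signScale, mul_mul_mul_comm, ← mul_pow, neg_one_mul, neg_neg, one_pow, one_mul, sq]
  have hγ := isRising_rowCoeff (α ^ 2)
  rw [sq, inv_mul_cancel_left₀ α_ne_zero, ← sq] at hγ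
  rw [twoColumn, scalar_rescale, map_mul, hscale]
  exact scalar_twoRowSum_mul_eq_zero nat_add_α_ne_zero hγ
    (fun u v => scalar_qRow_mul_qRow_rescale _ n u v) hsr hn _

theorem scalar_q_twoColumn {r s : ℕ} (hsr : s ≤ r) {i : ℕ} (hi : i ≤ s) :
    scalar (q (twoRow (r + i) (s - i) (sub_le_add_of_le hsr i)).transpose) (twoColumn r s) =
      binomSum α (r - s + i) i := by
  rw [q_eq_qMul, rowLens_transpose_twoRow, twoColumn_eq_sum, scalar_sum_right, binomSum]
  symm
  refine sum_subset_zero_on_sdiff (range_subset_range.2 (by omega)) ?_ ?_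
  · intro j hj
    simp only [mem_sdiff, mem_range] at hj
    -- For j > i the factor e_{s-j} is too short to produce s - i parts equal to 2.
    rw [scalar_smul_right, scalar_qMul_twos_ones _ _ _ _ (by omega), if_neg (by omega), mul_zero]
  · intro j hj
    have hj := mem_range.1 hj
    rw [scalar_smul_right, scalar_qMul_twos_ones _ _ _ _ (by omega), if_pos (by omega),
      show r - s + i - i = r - s by omega, show s - j - (s - i) = i - j by omega,
      show r + i - (s - i) = r - s + i + i by omega]

theorem scalar_q_twoColumn_eq_zero {r s : ℕ} (hsr : s ≤ r) {μ : YoungDiagram}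
    (hc : μ.card = r + s)
    (hμ : ∀ i, (hi : i ≤ s) → μ ≠ (twoRow (r + i) (s - i) (sub_le_add_of_le hsr i)).transpose) :
    scalar (q μ) (twoColumn r s) = 0 := by
  rw [twoColumn_eq_sum, scalar_sum_right]
  refine sum_eq_zero fun j hj => ?_
  have hj := mem_range.1 hj
  rw [scalar_smul_right, q_eq_qMul]
  by_cases h : ∀ x ∈ μ.rowLens, x ≤ 2
  · obtain ⟨a, b, hab, rfl⟩ := exists_eq_transpose_twoRow h
    rw [card_transpose, card_twoRow] at hc
    rw [rowLens_transpose_twoRow, scalar_qMul_twos_ones _ _ _ _ (by omega), if_neg, mul_zero]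
    intro hb
    refine hμ (s - b) (by omega) ?_
    congr 2 <;> omega
  · push Not at h
    obtain ⟨x, hx, h2⟩ := h
    rw [scalar_qMul_eSym_mul_eSym_eq_zero (s := (μ.rowLens : Multiset ℕ)) hx h2, mul_zero]

theorem toSeries_twoColumn {r s : ℕ} (hsr : s ≤ r) :
    toSeries (twoColumn r s) = ∑ i ∈ range (s + 1),
      binomSum α (r - s + i) i • m (twoRow (r + i) (s - i) (sub_le_add_of_le hsr i)).transpose := by
  classical
  rw [toSeries_eq_sum (homog_twoColumn r s)]
  symm
  refine sum_of_injOn (fun i => (twoRow (r + i) (s - i) (sub_le_add_of_le hsr i)).transpose) ?_ ?_ ?_ ?_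
  · intro i _ j _ h
    have := twoRow_injective (YoungDiagram.transpose_eq_iff.1 h)
    omega
  · intro i hi
    have hi := mem_range.1 (mem_coe.1 hi)
    rw [mem_coe, mem_diagrams, card_transpose, card_twoRow]
    omega
  · intro μ hμ hne
    rw [scalar_q_twoColumn_eq_zero hsr (mem_diagrams.1 hμ), zero_smul]
    intro i hi h
    exact hne ⟨i, mem_coe.2 (mem_range.2 (by omega)), h.symm⟩
  · intro i hi
    rw [scalar_q_twoColumn hsr (by have := mem_range.1 hi; omega)]

theorem binomSum_zero (θ : F) (r : ℕ) : binomSum θ r 0 = 1 := by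
  simp [binomSum, wellPoised]

/-- The roles of the two conditions are exchanged compared with rows: triangularity comes from the
explicit expansion, orthogonality from the vanishing theorem. -/
theorem isJack_twoColumn {r s : ℕ} (hsr : s ≤ r) :
    IsJack (twoRow r s hsr).transpose (twoColumn r s) := by
  refine ⟨sub_m_mem_span ?_ ?_ ?_, ?_⟩
  · rw [card_transpose, card_twoRow]
    exact homog_twoColumn r s
  · have := scalar_q_twoColumn hsr (Nat.zero_le s)
    simp only [add_zero, Nat.sub_zero] at this
    rw [this, binomSum_zero]
  · intro ν hc hν
    rw [card_transpose, card_twoRow] at hc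
    refine scalar_q_twoColumn_eq_zero hsr hc ?_
    intro i hi h
    rw [h] at hν
    refine hν (domLE_of_colLen_le _ ?_ ?_)
    · rw [card_transpose, card_twoRow]
      omega
    · rw [YoungDiagram.colLen_transpose, twoRow_rowLen_zero]
      omega
  · intro g hg
    refine scalar_eq_zero_of_mem_span (fun ν hν => ?_) hg
    by_cases hc : ν.card = r + s
    · refine scalar_mSym_eq_zero (r := r) (fun n hn g => scalar_twoColumn_eSym_mul hsr hn g) ?_
      by_contra h
      exact hν (domLE_of_colLen_le hsr hc (not_lt.1 h))
    · exact scalar_eq_zero_of_homog (homog_twoColumn r s) (homog_mSym ν) (Ne.symm hc)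

/-! ### Normalization of the two-column functions -/

theorem bCoeff_eq {r s i : ℕ} (hsr : s ≤ r) (hi : i ≤ s) :
    bCoeff r s s * binomSum α (r - s + i) i = bCoeff r s (s - i) := by
  obtain ⟨a, rfl⟩ := Nat.exists_eq_add_of_le hsr
  obtain ⟨k, rfl⟩ := Nat.exists_eq_add_of_le' hi
  have hsplit : ∀ n : ℕ,
      ∏ j ∈ Icc 1 n, ((((k + i : ℕ) : F) + 1 - j) * (α + ((k + i + a : ℕ) : F) + 1 - j)) =
      ∏ j ∈ range n, ((((k + i : ℕ) : F) - j) * (α + ((k + i + a : ℕ) : F) - j)) := by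
    intro n
    induction n with
    | zero => simp
    | succ n ih =>
      rw [prod_Icc_succ_top (by omega), ih, prod_range_succ]
      push_cast
      ring
  have hfac : (i.factorial : F) = ∏ t ∈ range i, ((t : F) + 1) := by
    rw [← prod_range_add_one_eq_factorial]
    push_cast
    rfl
  have hbin := binomSum_eq nat_add_α_ne_zero a i
  rw [mul_assoc, hfac, ← prod_mul_distrib] at hbin
  -- The last i factors of b_s, read backwards, are the denominator in `binomSum_eq`; the first k =
  -- s - i factors are those of b_k.
  have htail : ∏ j ∈ range i, ((((k + i : ℕ) : F) - ((k + j : ℕ) : F)) *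
      (α + ((k + i + a : ℕ) : F) - ((k + j : ℕ) : F))) =
      ∏ t ∈ range i, (((t : F) + 1) * (a + 1 + t + α)) := by
    rw [← prod_range_reflect]
    refine prod_congr rfl fun t ht => ?_
    have ht := mem_range.1 ht
    obtain ⟨u, rfl⟩ := Nat.exists_eq_add_of_lt ht
    rw [show t + u + 1 - 1 - t = u by omega]
    push_cast
    ring
  rw [bCoeff, bCoeff, hsplit, show k + i - i = k by omega, hsplit,
    prod_range_add, htail, show k + i + (k + i + a) - 2 * (k + i) = a by omega,
    show k + i + (k + i + a) - 2 * k = 2 * i + a by omega, ← hbin,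
    show k + i + a - (k + i) + i = i + a by omega]
  ring

theorem coeffOnes_twoColumn {r s : ℕ} (hsr : s ≤ r) :
    coeffOnes (r + s) (twoColumn r s) = binomSum α r s := by
  have hval : ∀ j, (∑ i ∈ range (r + s), Finsupp.single i 1 : ℕ →₀ ℕ) j =
      if j < r + s then 1 else 0 := by
    intro j
    rw [Finsupp.finsetSum_apply]
    simp [Finsupp.single_apply]
  have hsupp : (∑ i ∈ range (r + s), Finsupp.single i 1 : ℕ →₀ ℕ).support = range (r + s) := by
    ext j
    rw [Finsupp.mem_support_iff, hval, mem_range]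
    split_ifs with h <;> simp [h]
  have h := scalar_q_twoColumn hsr le_rfl
  rw [show r - s + s = r by omega] at h
  rw [coeffOnes, ← h]
  symm
  refine scalar_q_eq_coeff ?_ _
  rw [rowLens_transpose_twoRow, Nat.sub_self, Multiset.replicate_zero, zero_add, Nat.sub_zero]
  refine Multiset.eq_replicate.2 ⟨by rw [card_exps, hsupp, card_range], fun x hx => ?_⟩
  obtain ⟨j, hj, rfl⟩ := Multiset.mem_map.1 hx
  rw [hval, if_pos (mem_range.1 (hsupp ▸ hj : j ∈ range (r + s)))]

theorem toSeries_J_transpose_twoRow {r s : ℕ} (hsr : s ≤ r) :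
    toSeries (J (twoRow r s hsr).transpose) = ∑ i ∈ range (s + 1),
      bCoeff r s (s - i) • m (twoRow (r + i) (s - i) (sub_le_add_of_le hsr i)).transpose := by
  -- At i = s the relation reads b_s · `binomSum` = b_0 = (r+s)!, so the scalar that normalizes the
  -- coefficient of m_{(1^{r+s})} is b_s.
  have hb := bCoeff_eq hsr le_rfl
  rw [show r - s + s = r by omega, Nat.sub_self] at hb
  have hb0 : bCoeff r s 0 = ((r + s).factorial : F) := by
    simp [bCoeff, add_comm s r]
  have hne : binomSum α r s ≠ 0 := by
    intro h0
    rw [h0, mul_zero, hb0] at hb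
    exact (Nat.factorial_ne_zero (r + s)) (by exact_mod_cast hb.symm)
  rw [J, eq_P_of_isJack (isJack_twoColumn hsr), card_transpose, card_twoRow,
    coeffOnes_twoColumn hsr, ← hb0, ← hb, mul_div_cancel_right₀ _ hne, map_smul,
    toSeries_twoColumn hsr, smul_sum]
  refine sum_congr rfl fun i hi => ?_
  rw [smul_smul, bCoeff_eq hsr (by have := mem_range.1 hi; omega)]

end Jack

theorem proposition5p8 (r s : ℕ) (h : s ≤ r) :
    Jack.Q (Jack.twoRow r s h) =
        ∑ i ∈ Finset.range (s + 1),
          Jack.aCoeff (r - s) i • Jack.q (Jack.twoRow (r + i) (s - i) (by omega)) ∧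
      Jack.toSeries (Jack.J (Jack.twoRow r s h).transpose) =
        ∑ i ∈ Finset.range (s + 1),
          Jack.bCoeff r s (s - i) • Jack.m (Jack.twoRow (r + i) (s - i) (by omega)).transpose := by
  refine ⟨?_, Jack.toSeries_J_transpose_twoRow h⟩
  rw [Jack.Q_twoRow h, Jack.twoRowSum]
  exact Finset.sum_congr rfl fun i _ => by rw [Jack.q_twoRow, Jack.aCoeff_eq_wellPoised]
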